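/- Let $X=(x^{(i)}_k)\in\mathbb{R}^{N_D\times d}$ ($1\le k\le N_D$, $1\le i\le d$) be a design matrix and $\vec y\in\mathbb{R}^{N_D}$, with $d,N_D\ge 1$, and put $W=\frac1{N_D}X^TX$, $\vec z=\frac1{N_D}X^T\vec y$. Fix a format in which bit strings of $m$ bits represent real numbers, and assume that all entries of $X$ and $\vec y$ are represented in it. The data are accessed through unitary oracles $P_x:|i\rangle|k\rangle|0\rangle\mapsto|i\rangle|k\rangle|x^{(i)}_k\rangle$ and $P_y:|k\rangle|0\rangle\mapsto|k\rangle|y_k\rangle$, where $|x\rangle$ is the computational basis state of $m$ qubits given by a bit string that represents $x$; nothing is assumed on the action of the oracles on other basis states, and a use of an oracle means an application of it or of its inverse. A quantum algorithm consists of finitely many quantum circuits, each started in a fixed basis state, built from data-independent unitaries and uses of the oracles, and measured at the end in the computational basis, followed by classical post-processing of the outcomes. Theorem. For every $c>0$ there is a constant $C>0$, depending only on $c$, such that for all $d,N_D\ge1$, every number format, all $\kappa\ge1$ and all $\epsilon>0$ there is a quantum algorithm that makes at most $$C\,\max\left\{\frac{d^{3/2}\kappa^4}{\epsilon},\,d\kappa^2\right\}d^2\log(d+1)$$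 uses of $P_x$ and at most $$C\,\max\left\{\frac{d^{3/2}\kappa^4}{\epsilon},\,d\kappa^2\right\}d\log(d+1)$$ uses of $P_y$ and has the following property. For all data $X,\vec y$ such that $X$ has rank $d$ and condition number $\sigma_{\max}(X)/\sigma_{\min}(X)\le\kappa$, all entries of $X$ and $\vec y$ lie in $[0,1]$, and $w_{ii}=\frac1{N_D}\sum_{k}(x^{(i)}_k)^2>c$ for every $i$, and for all oracles $P_x,P_y$ for these data, the algorithm outputs, with probability larger than $99\%$, a vector $\hat a\in\mathbb{R}^d$ with $\|\hat a-\vec a\|_\infty\le C\epsilon$, where $\vec a=W^{-1}\vec z$ is the vector of least-squares coefficients. -/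

import Mathlib

open scoped Matrix Kronecker

noncomputable section

namespace QLinReg

/-! ### Linear algebra of least squares -/

/-- `W = (1/N) Xᵀ X`. -/
def gram {d N : ℕ} (X : Matrix (Fin N) (Fin d) ℝ) : Matrix (Fin d) (Fin d) ℝ :=
  (1 / (N : ℝ)) • (Xᵀ * X)

/-- `z = (1/N) Xᵀ y`. -/
def moment {d N : ℕ} (X : Matrix (Fin N) (Fin d) ℝ) (y : Fin N → ℝ) : Fin d → ℝ :=
  (1 / (N : ℝ)) • (Xᵀ *ᵥ y)

/-- The regression coefficients `a = W⁻¹ z`. -/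
def coeffs {d N : ℕ} (X : Matrix (Fin N) (Fin d) ℝ) (y : Fin N → ℝ) : Fin d → ℝ :=
  (gram X)⁻¹ *ᵥ moment X y

/-- The condition number `σ_max / σ_min` of a matrix with `d ≥ 1` columns and rank `d`:
Mathlib lists singular values in decreasing order, starting at index `0`, so that the
`d` singular values of such a matrix are those with the indices `0, …, d - 1`. -/
def condNumber {d N : ℕ} (X : Matrix (Fin N) (Fin d) ℝ) : ℝ :=
  (Matrix.toEuclideanLin X).singularValues 0 / (Matrix.toEuclideanLin X).singularValues (d - 1)

/-! ### Oracles -/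

/-- Bit strings of length `m`, the computational basis states of `m` qubits. -/
abbrev Bits (m : ℕ) : Type := Fin m → Bool

/-- The all-zero bit string. -/
def zeroBits (m : ℕ) : Bits m := fun _ => false

/-- The basis vector `|s⟩`. -/
def ket {α : Type} [DecidableEq α] (s : α) : α → ℂ := Pi.single s 1

/-- `P` is an oracle for the design matrix: a unitary operator with
`|i⟩|k⟩|0⟩ ↦ |i⟩|k⟩|v⟩`, where the bit string `v` represents the number `X k i`, that is,
`val v = X k i`. The action of `P` on the other basis states is not specified. -/
def IsOracleX {d N m : ℕ} (val : Bits m → ℝ) (X : Matrix (Fin N) (Fin d) ℝ)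
    (P : Matrix (Fin d × Fin N × Bits m) (Fin d × Fin N × Bits m) ℂ) : Prop :=
  P ∈ Matrix.unitaryGroup (Fin d × Fin N × Bits m) ℂ ∧
    ∀ i k, ∃ v : Bits m, val v = X k i ∧ P *ᵥ ket (i, k, zeroBits m) = ket (i, k, v)

/-- `P` is an oracle for the objective variable: a unitary operator with
`|k⟩|0⟩ ↦ |k⟩|v⟩`, where `val v = y k`. -/
def IsOracleY {N m : ℕ} (val : Bits m → ℝ) (y : Fin N → ℝ)
    (P : Matrix (Fin N × Bits m) (Fin N × Bits m) ℂ) : Prop :=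
  P ∈ Matrix.unitaryGroup (Fin N × Bits m) ℂ ∧
    ∀ k, ∃ v : Bits m, val v = y k ∧ P *ᵥ ket (k, zeroBits m) = ket (k, v)

/-! ### Quantum query algorithms -/

/-- The computational basis of the machine: the query registers (index `i`, index `k`, value
register of `m` qubits), together with a work register with basis `ω`. -/
abbrev Basis (d N m : ℕ) (ω : Type) : Type := (Fin d × Fin N × Bits m) × ω

/-- One step of a quantum circuit: a unitary operator that does not depend on the data, or a use
of an oracle or of its inverse. -/
inductive Step (d N m : ℕ) (ω : Type) [Fintype ω] [DecidableEq ω] : Type where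
  | gate (U : Matrix.unitaryGroup (Basis d N m ω) ℂ) : Step d N m ω
  | useX : Step d N m ω
  | useXInv : Step d N m ω
  | useY : Step d N m ω
  | useYInv : Step d N m ω

namespace Step

variable {d N m : ℕ} {ω : Type} [Fintype ω] [DecidableEq ω]

/-- The operator that a step applies when the oracles are `Px` and `Py`. -/
def op (Px : Matrix (Fin d × Fin N × Bits m) (Fin d × Fin N × Bits m) ℂ)
    (Py : Matrix (Fin N × Bits m) (Fin N × Bits m) ℂ) :
    Step d N m ω → Matrix (Basis d N m ω) (Basis d N m ω) ℂ
  | gate U => U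
  | useX => Px ⊗ₖ (1 : Matrix ω ω ℂ)
  | useXInv => Pxᴴ ⊗ₖ (1 : Matrix ω ω ℂ)
  | useY => ((1 : Matrix (Fin d) (Fin d) ℂ) ⊗ₖ Py) ⊗ₖ (1 : Matrix ω ω ℂ)
  | useYInv => ((1 : Matrix (Fin d) (Fin d) ℂ) ⊗ₖ Pyᴴ) ⊗ₖ (1 : Matrix ω ω ℂ)

/-- Number of uses of the design matrix oracle (inverse included) in a step. -/
def costX : Step d N m ω → ℕ
  | useX => 1
  | useXInv => 1
  | _ => 0

/-- Number of uses of the objective variable oracle (inverse included) in a step. -/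
def costY : Step d N m ω → ℕ
  | useY => 1
  | useYInv => 1
  | _ => 0

end Step

/-- A quantum query algorithm with output in `ℝ^d`. It runs finitely many quantum circuits
(indexed by `ρ`), each from the basis state `init`, measures all registers in the
computational basis at the end of each run, and computes its output classically from the
outcomes of all the runs. The case of one run is the usual circuit model with a single final
measurement. No part of the algorithm depends on the data, which enters only through the
oracles. -/
structure QueryAlgorithm (d N m : ℕ) where
  /-- basis of the work register -/
  ω : Type
  [fintypeWork : Fintype ω]
  [decEqWork : DecidableEq ω]
  /-- index type of the runs -/
  ρ : Type
  [fintypeRuns : Fintype ρ]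
  [decEqRuns : DecidableEq ρ]
  /-- initial basis state -/
  init : Basis d N m ω
  /-- the circuits, as lists of steps in the order of execution -/
  circuit : ρ → List (Step d N m ω)
  /-- classical post-processing of the measured outcomes -/
  output : (ρ → Basis d N m ω) → (Fin d → ℝ)

attribute [instance] QueryAlgorithm.fintypeWork QueryAlgorithm.decEqWork
  QueryAlgorithm.fintypeRuns QueryAlgorithm.decEqRuns

namespace QueryAlgorithm

variable {d N m : ℕ} (A : QueryAlgorithm d N m)

/-- Total number of uses of the design matrix oracle, over all the runs. -/
def usesX : ℕ := ∑ r, ((A.circuit r).map Step.costX).sum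

/-- Total number of uses of the objective variable oracle, over all the runs. -/
def usesY : ℕ := ∑ r, ((A.circuit r).map Step.costY).sum

/-- The state of the machine at the end of run `r`, before the measurement. -/
def finalState (Px : Matrix (Fin d × Fin N × Bits m) (Fin d × Fin N × Bits m) ℂ)
    (Py : Matrix (Fin N × Bits m) (Fin N × Bits m) ℂ) (r : A.ρ) : Basis d N m A.ω → ℂ :=
  (A.circuit r).foldl (fun ψ s => s.op Px Py *ᵥ ψ) (ket A.init)

/-- The probability that the output lies in `S`: each run `r` gives the outcome `b` with
probability `|⟨b|ψ_r⟩|²`, and the runs are independent. -/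
def prob (Px : Matrix (Fin d × Fin N × Bits m) (Fin d × Fin N × Bits m) ℂ)
    (Py : Matrix (Fin N × Bits m) (Fin N × Bits m) ℂ) (S : Set (Fin d → ℝ)) : ℝ :=
  ∑ o : A.ρ → Basis d N m A.ω,
    Set.indicator {o | A.output o ∈ S} (fun o => ∏ r, ‖A.finalState Px Py r (o r)‖ ^ 2) o

end QueryAlgorithm

end QLinReg

end

noncomputable section

namespace QLinReg

/-! Every entry of W and z is an average over k of products in [0, 1]. Two queries load both factors
in superposition over k into a state ψ, and the entry becomes the expectation μ = ⟨ψ|R|ψ⟩ of a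
data-independent reflection R acting on one qubit.

Let G be the product of the reflection at ψ and R. The vectors g_n = Gⁿψ satisfy g_{n+2} + g_n = 2μ
g_{n+1} (`reflectVec_mul_sq_mulVec`). Hence a superposition over a clock of length 4q + 1, carrying
g_n at time n with slowly varying amplitudes that vanish at both ends, is nearly an eigenvector with
eigenvalue μ of half the adjacency matrix of a path. Measuring this fixed matrix on the clock
returns μ with mean square error at most 3/q², for O(q) queries
(`sum_norm_sq_pathMatrix_tent_sub_le`, `sum_sq_mul_norm_sq_run_estimationCircuit_le`). Chebyshev's
inequality and a majority vote over O(log(d+1)) runs make all d(d+1) estimates accurate at once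
(`one_sub_le_sum_indicator`, `exists_algorithm`).

The rest is deterministic. Since σ_max² is at least Nc, the form of W is bounded below by l = c/κ²
(`le_dotProduct_gram_mulVec`). Entry errors δ with dδ ≤ l/2 move the solution by at most a constant
times d^{3/2}δ/l² (`norm_inv_mulVec_sub_coeffs_le`). The smallness condition and the target accuracy
are the two terms of the maximum. Only the d entries of z query P_y, which saves a factor d there.
-/

/-! ### Coercivity of the Gram matrix -/

theorem norm_sq_map_eq_sum_singularValues {n : ℕ} {E F : Type*}
    [NormedAddCommGroup E] [InnerProductSpace ℝ E] [FiniteDimensional ℝ E]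
    [NormedAddCommGroup F] [InnerProductSpace ℝ F] [FiniteDimensional ℝ F]
    (T : E →ₗ[ℝ] F) (hn : Module.finrank ℝ E = n) :
    ∃ b : OrthonormalBasis (Fin n) ℝ E,
      ∀ v, ‖T v‖ ^ 2 = ∑ i : Fin n, T.singularValues i ^ 2 * inner ℝ (b i) v ^ 2 := by
  refine ⟨T.isSymmetric_adjoint_comp_self.eigenvectorBasis hn, fun v => ?_⟩
  set b := T.isSymmetric_adjoint_comp_self.eigenvectorBasis hn
  have h1 : ‖T v‖ ^ 2 = inner ℝ ((LinearMap.adjoint T ∘ₗ T) v) v := by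
    rw [LinearMap.comp_apply, LinearMap.adjoint_inner_left, real_inner_self_eq_norm_sq]
  rw [h1, ← b.sum_inner_mul_inner]
  refine Finset.sum_congr rfl fun i _ => ?_
  have h2 : inner ℝ ((LinearMap.adjoint T ∘ₗ T) v) (b i) =
      T.singularValues i ^ 2 * inner ℝ (b i) v := by
    rw [T.isSymmetric_adjoint_comp_self v (b i),
      T.isSymmetric_adjoint_comp_self.apply_eigenvectorBasis hn i, T.sq_singularValues_fin hn i,
      real_inner_comm, inner_smul_left]
    simp [b]
  rw [h2]; ring

/-- A lower bound on the column norms and an upper bound on the condition number bound the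
quadratic form of the Gram matrix from below. -/
theorem le_norm_sq_map_of_condNumber {d N : ℕ} (hd : 0 < d) {X : Matrix (Fin N) (Fin d) ℝ}
    {κ μ : ℝ} (hκ : 1 ≤ κ) (hrank : X.rank = d) (hcond : condNumber X ≤ κ)
    (hcol : ∃ u : EuclideanSpace ℝ (Fin d), ‖u‖ = 1 ∧ μ ≤ ‖Matrix.toEuclideanLin X u‖ ^ 2)
    (v : EuclideanSpace ℝ (Fin d)) :
    μ / κ ^ 2 * ‖v‖ ^ 2 ≤ ‖Matrix.toEuclideanLin X v‖ ^ 2 := by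
  set T := Matrix.toEuclideanLin X with hT
  have hn : Module.finrank ℝ (EuclideanSpace ℝ (Fin d)) = d := by simp
  obtain ⟨b, hb⟩ := norm_sq_map_eq_sum_singularValues T hn
  have hsum : ∀ v, ∑ i, inner ℝ (b i) v ^ 2 = ‖v‖ ^ 2 := fun v => by
    rw [← b.sum_sq_norm_inner_right v]; simp
  have hrk : Module.finrank ℝ T.range = d := by
    refine Eq.trans ?_ hrank
    rw [Matrix.rank_eq_finrank_range_toLin X (EuclideanSpace.basisFun _ ℝ).toBasis
      (EuclideanSpace.basisFun _ ℝ).toBasis]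
    rfl
  -- Full rank makes the denominator of `condNumber` nonzero; with the convention x / 0 = 0 the
  -- bound on the quotient would otherwise say nothing.
  have hpos : 0 < T.singularValues (d - 1) := by
    rw [T.singularValues_pos_iff_lt_finrank_range, hrk]; omega
  have hle : T.singularValues 0 ≤ κ * T.singularValues (d - 1) := by
    rw [condNumber, div_le_iff₀ hpos] at hcond; exact hcond
  obtain ⟨u, hu, hμu⟩ := hcol
  have h0 : μ ≤ T.singularValues 0 ^ 2 := by
    refine hμu.trans ?_
    rw [hb]
    calc _ ≤ ∑ i : Fin d, T.singularValues 0 ^ 2 * inner ℝ (b i) u ^ 2 := by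
          refine Finset.sum_le_sum fun i _ => mul_le_mul_of_nonneg_right ?_ (sq_nonneg _)
          exact pow_le_pow_left₀ (T.singularValues_nonneg _)
            (T.singularValues_antitone (Nat.zero_le _)) 2
      _ = _ := by rw [← Finset.mul_sum, hsum, hu]; simp
  have h1 : μ / κ ^ 2 ≤ T.singularValues (d - 1) ^ 2 := by
    rw [div_le_iff₀ (by positivity)]
    calc μ ≤ _ := h0
      _ ≤ (κ * T.singularValues (d - 1)) ^ 2 := pow_le_pow_left₀ (T.singularValues_nonneg _) hle 2
      _ = _ := by ring
  rw [hb, ← hsum, Finset.mul_sum]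
  refine Finset.sum_le_sum fun i _ => mul_le_mul_of_nonneg_right (h1.trans ?_) (sq_nonneg _)
  exact pow_le_pow_left₀ (T.singularValues_nonneg _) (T.singularValues_antitone (by omega)) 2

theorem dotProduct_gram_mulVec {d N : ℕ} (X : Matrix (Fin N) (Fin d) ℝ) (v : Fin d → ℝ) :
    v ⬝ᵥ gram X *ᵥ v = (1 / (N : ℝ)) * ‖Matrix.toEuclideanLin X (WithLp.toLp 2 v)‖ ^ 2 := by
  rw [gram, Matrix.smul_mulVec, dotProduct_smul, smul_eq_mul, ← Matrix.mulVec_mulVec,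
    Matrix.dotProduct_mulVec, Matrix.vecMul_transpose, EuclideanSpace.norm_sq_eq]
  simp [Matrix.toLpLin_apply, dotProduct, sq]

theorem le_dotProduct_gram_mulVec {d N : ℕ} (hd : 0 < d) (hN : 0 < N)
    {X : Matrix (Fin N) (Fin d) ℝ} {κ c : ℝ} (hκ : 1 ≤ κ) (hrank : X.rank = d)
    (hcond : condNumber X ≤ κ) (hdiag : ∀ i, c < gram X i i) (v : Fin d → ℝ) :
    c / κ ^ 2 * (v ⬝ᵥ v) ≤ v ⬝ᵥ gram X *ᵥ v := by
  have hN' : (0 : ℝ) < N := by exact_mod_cast hN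
  have key := le_norm_sq_map_of_condNumber hd (μ := N * c) hκ hrank hcond
    -- The test vector is a coordinate vector: its image is a column of X, of squared norm N times a
    -- diagonal entry of W.
    ⟨EuclideanSpace.single ⟨0, hd⟩ 1, by simp, by
      have h1 := hdiag ⟨0, hd⟩
      have h2 := dotProduct_gram_mulVec X (Pi.single ⟨0, hd⟩ 1)
      rw [Matrix.mulVec_single_one, single_one_dotProduct, Matrix.col_apply] at h2
      rw [h2, one_div, inv_mul_eq_div, lt_div_iff₀ hN', mul_comm] at h1
      exact h1.le⟩ (WithLp.toLp 2 v)
  rw [dotProduct_gram_mulVec, one_div, inv_mul_eq_div, le_div_iff₀ hN']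
  refine le_trans (le_of_eq ?_) key
  rw [EuclideanSpace.norm_sq_eq]
  simp only [dotProduct, Real.norm_eq_abs, sq_abs]
  simp only [← sq]
  ring

/-! ### Perturbation of a linear system -/

theorem abs_dotProduct_mulVec_le {d : ℕ} {E : Matrix (Fin d) (Fin d) ℝ} {δ : ℝ}
    (hE : ∀ i j, |E i j| ≤ δ) (u v : Fin d → ℝ) :
    |u ⬝ᵥ E *ᵥ v| ≤ δ * ((∑ i, |u i|) * ∑ i, |v i|) := by
  simp only [dotProduct, Matrix.mulVec]
  calc _ ≤ ∑ i, |u i| * ∑ j, δ * |v j| := by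
        refine (Finset.abs_sum_le_sum_abs _ _).trans (Finset.sum_le_sum fun i _ => ?_)
        rw [abs_mul]
        refine mul_le_mul_of_nonneg_left ?_ (abs_nonneg _)
        refine (Finset.abs_sum_le_sum_abs _ _).trans (Finset.sum_le_sum fun j _ => ?_)
        rw [abs_mul]
        exact mul_le_mul_of_nonneg_right (hE i j) (abs_nonneg _)
    _ = _ := by rw [← Finset.sum_mul, ← Finset.mul_sum]; ring

theorem sum_abs_le_sqrt {d : ℕ} (v : Fin d → ℝ) :
    ∑ i, |v i| ≤ √d * √(v ⬝ᵥ v) := by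
  rw [← Real.sqrt_mul (Nat.cast_nonneg d)]
  refine Real.le_sqrt_of_sq_le ?_
  have := sq_sum_le_card_mul_sum_sq (s := Finset.univ) (f := fun i => |v i|)
  simpa [dotProduct, sq] using this

theorem norm_le_sqrt_dotProduct {d : ℕ} (v : Fin d → ℝ) : ‖v‖ ≤ √(v ⬝ᵥ v) := by
  refine (pi_norm_le_iff_of_nonneg (Real.sqrt_nonneg _)).2 fun i => Real.le_sqrt_of_sq_le ?_
  rw [Real.norm_eq_abs, sq_abs, sq]
  exact Finset.single_le_sum (f := fun i => v i * v i) (fun i _ => mul_self_nonneg _)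
    (Finset.mem_univ i)

/-- The a priori estimate for coercive systems: one factor |v| cancels. -/
theorem sqrt_dotProduct_le_of_le {d : ℕ} {v : Fin d → ℝ} {l B : ℝ} (hl : 0 < l) (hB : 0 ≤ B)
    (h : l * (v ⬝ᵥ v) ≤ B * √(v ⬝ᵥ v)) : √(v ⬝ᵥ v) ≤ B / l := by
  have h0 : 0 ≤ v ⬝ᵥ v := Finset.sum_nonneg fun i _ => mul_self_nonneg _
  rw [le_div_iff₀ hl]
  rcases (Real.sqrt_nonneg (v ⬝ᵥ v)).eq_or_lt with h1 | h1
  · rw [← h1]; simpa using hB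
  · refine le_of_mul_le_mul_right ?_ h1
    rw [mul_right_comm, Real.mul_self_sqrt h0, mul_comm _ l]; exact h

theorem isUnit_det_of_coercive {d : ℕ} {A : Matrix (Fin d) (Fin d) ℝ} {l : ℝ} (hl : 0 < l)
    (h : ∀ v, l * (v ⬝ᵥ v) ≤ v ⬝ᵥ A *ᵥ v) : IsUnit A.det := by
  rw [← Matrix.isUnit_iff_isUnit_det, ← Matrix.mulVec_injective_iff_isUnit]
  intro u v huv
  have huv' : A *ᵥ (u - v) = 0 := by rw [Matrix.mulVec_sub, sub_eq_zero]; exact huv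
  have h1 := h (u - v)
  rw [huv', dotProduct_zero] at h1
  have h2 : (u - v) ⬝ᵥ (u - v) = 0 :=
    le_antisymm (nonpos_of_mul_nonpos_right h1 hl)
      (Finset.sum_nonneg fun i _ => mul_self_nonneg _)
  exact sub_eq_zero.1 (dotProduct_self_eq_zero.1 h2)

/-- Stability of the solution of a linear system with a coercive matrix under entrywise
perturbations. -/
theorem norm_inv_mulVec_sub_le {d : ℕ} {W W' : Matrix (Fin d) (Fin d) ℝ} {z z' : Fin d → ℝ}
    {l δ : ℝ} (hl : 0 < l) (hδ : 0 ≤ δ) (hW : ∀ v, l * (v ⬝ᵥ v) ≤ v ⬝ᵥ W *ᵥ v)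
    (hz : ∀ i, |z i| ≤ 1) (hW' : ∀ i j, |W' i j - W i j| ≤ δ) (hz' : ∀ i, |z' i - z i| ≤ δ)
    (hδl : d * δ ≤ l / 2) :
    ‖W'⁻¹ *ᵥ z' - W⁻¹ *ᵥ z‖ ≤ 2 / l * (√d * δ + d * √d * δ / l) := by
  have hl2 : 0 < l / 2 := by positivity
  -- Comparing the 1-norm with the 2-norm costs √d on each side, so an entrywise error δ is an
  -- operator error dδ.
  have bound : ∀ u v, |u ⬝ᵥ (W' - W) *ᵥ v| ≤ d * δ * √(u ⬝ᵥ u) * √(v ⬝ᵥ v) := by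
    intro u v
    refine (abs_dotProduct_mulVec_le hW' u v).trans ?_
    calc _ ≤ δ * ((√d * √(u ⬝ᵥ u)) * (√d * √(v ⬝ᵥ v))) := by
          have := sum_abs_le_sqrt u
          have := sum_abs_le_sqrt v
          gcongr
      _ = (√d * √d) * δ * √(u ⬝ᵥ u) * √(v ⬝ᵥ v) := by ring
      _ = _ := by rw [Real.mul_self_sqrt (Nat.cast_nonneg d)]
  have bound' : ∀ (u w : Fin d → ℝ) (B : ℝ), 0 ≤ B → (∀ i, |w i| ≤ B) →
      u ⬝ᵥ w ≤ √d * B * √(u ⬝ᵥ u) := by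
    intro u w B hB hw
    calc u ⬝ᵥ w ≤ ∑ i, |u i| * B := by
          refine Finset.sum_le_sum fun i _ => (le_abs_self _).trans ?_
          rw [abs_mul]; gcongr; exact hw i
      _ ≤ (√d * √(u ⬝ᵥ u)) * B := by
          rw [← Finset.sum_mul]; gcongr; exact sum_abs_le_sqrt u
      _ = _ := by ring
  -- The perturbation consumes at most half of the coercivity; in particular the estimated matrix is
  -- invertible.
  have hcoer : ∀ v, l / 2 * (v ⬝ᵥ v) ≤ v ⬝ᵥ W' *ᵥ v := by
    intro v
    have h0 : 0 ≤ v ⬝ᵥ v := Finset.sum_nonneg fun i _ => mul_self_nonneg _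
    have h1 := neg_le_of_abs_le (bound v v)
    rw [Matrix.sub_mulVec, dotProduct_sub, mul_assoc, Real.mul_self_sqrt h0] at h1
    nlinarith [hW v, mul_le_mul_of_nonneg_right hδl h0]
  have hu := isUnit_det_of_coercive hl hW
  have hu' := isUnit_det_of_coercive hl2 hcoer
  set a := W⁻¹ *ᵥ z with ha
  set e := W'⁻¹ *ᵥ z' - a with he
  have hWa : W *ᵥ a = z := by
    rw [ha, Matrix.mulVec_mulVec, Matrix.mul_nonsing_inv _ hu, Matrix.one_mulVec]
  -- The residual equation involves the exact solution a, whose norm is at most √d / l.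
  have hW'e : W' *ᵥ e = (z' - z) - (W' - W) *ᵥ a := by
    rw [he, Matrix.mulVec_sub, Matrix.mulVec_mulVec, Matrix.mul_nonsing_inv _ hu',
      Matrix.one_mulVec, Matrix.sub_mulVec, hWa]
    abel
  have hna : √(a ⬝ᵥ a) ≤ √d * 1 / l := by
    refine sqrt_dotProduct_le_of_le hl (by positivity) ((hW a).trans ?_)
    rw [hWa]; exact bound' a z 1 zero_le_one hz
  have hne : √(e ⬝ᵥ e) ≤ (√d * δ + d * δ * (√d * 1 / l)) / (l / 2) := by
    refine sqrt_dotProduct_le_of_le hl2 (by positivity) ((hcoer e).trans ?_)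
    rw [hW'e, dotProduct_sub]
    have h1 := bound' e (z' - z) δ hδ hz'
    have h2 := neg_le_of_abs_le (bound e a)
    have h3 : d * δ * √(e ⬝ᵥ e) * √(a ⬝ᵥ a) ≤ d * δ * √(e ⬝ᵥ e) * (√d * 1 / l) := by gcongr
    nlinarith
  refine (norm_le_sqrt_dotProduct e).trans (hne.trans (le_of_eq ?_))
  field_simp

/-! ### Vectors and unitary operators -/

section Vectors

theorem star_dotProduct_self {α : Type*} [Fintype α] (v : α → ℂ) :
    star v ⬝ᵥ v = ((∑ a, ‖v a‖ ^ 2 : ℝ) : ℂ) := by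
  simp only [dotProduct, Pi.star_apply, RCLike.star_def, Complex.conj_mul']
  push_cast; rfl

variable {α : Type*} [Fintype α] [DecidableEq α]

theorem sum_norm_sq_mulVec {U : Matrix α α ℂ} (hU : U ∈ Matrix.unitaryGroup α ℂ) (v : α → ℂ) :
    ∑ a, ‖(U *ᵥ v) a‖ ^ 2 = ∑ a, ‖v a‖ ^ 2 := by
  have h : star (U *ᵥ v) ⬝ᵥ (U *ᵥ v) = star v ⬝ᵥ v := by
    rw [Matrix.star_mulVec, Matrix.dotProduct_mulVec, Matrix.vecMul_vecMul,
      ← Matrix.star_eq_conjTranspose, Matrix.mem_unitaryGroup_iff'.1 hU, Matrix.vecMul_one]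
  rw [star_dotProduct_self, star_dotProduct_self] at h
  exact_mod_cast h

/-- A unit vector extends to an orthonormal basis, whose vectors are the columns of U. This supplies
the state preparation gates. -/
theorem exists_unitary_mulVec_single {v : α → ℂ} (hv : ∑ a, ‖v a‖ ^ 2 = 1) (s : α) :
    ∃ U : Matrix.unitaryGroup α ℂ, (U : Matrix α α ℂ) *ᵥ Pi.single s 1 = v := by
  have ho : Orthonormal ℂ
      (Set.domRestrict {s} fun _ : α => (WithLp.toLp 2 v : EuclideanSpace ℂ α)) := by
    constructor
    · intro i
      have : ‖(WithLp.toLp 2 v : EuclideanSpace ℂ α)‖ ^ 2 = 1 := by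
        rw [EuclideanSpace.norm_sq_eq]; exact hv
      exact (pow_eq_one_iff_of_nonneg (norm_nonneg _) two_ne_zero).1 this
    · intro i j hij
      exact absurd (Subtype.ext (i.2.trans j.2.symm)) hij
  obtain ⟨b, hb⟩ := ho.exists_orthonormalBasis_extension_of_card_eq (by simp)
  refine ⟨⟨_, (EuclideanSpace.basisFun α ℂ).toMatrix_orthonormalBasis_mem_unitary b⟩, ?_⟩
  rw [Matrix.mulVec_single_one]
  ext a
  simp [Module.Basis.toMatrix_apply, hb s rfl]

/-- The permutation operator of a permutation of the basis. -/
def permUnitary (σ : Equiv.Perm α) : Matrix.unitaryGroup α ℂ :=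
  ⟨Matrix.of fun a b => if a = σ b then 1 else 0, by
    rw [Matrix.mem_unitaryGroup_iff']
    ext a b
    simp [Matrix.mul_apply, Matrix.one_apply, eq_comm]⟩

theorem permUnitary_mulVec_single (σ : Equiv.Perm α) (a : α) :
    (permUnitary σ : Matrix α α ℂ) *ᵥ Pi.single a 1 = Pi.single (σ a) 1 := by
  rw [Matrix.mulVec_single_one]
  ext b
  simp [permUnitary, Pi.single_apply]

/-- The reflection `2 |v⟩⟨v| - 1`. -/
def reflectVec (v : α → ℂ) : Matrix α α ℂ := (2 : ℂ) • Matrix.vecMulVec v (star v) - 1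

theorem reflectVec_mulVec (v w : α → ℂ) :
    reflectVec v *ᵥ w = (2 * (star v ⬝ᵥ w)) • v - w := by
  rw [reflectVec, Matrix.sub_mulVec, Matrix.smul_mulVec, Matrix.vecMulVec_mulVec, Matrix.one_mulVec,
    op_smul_eq_smul, smul_smul]

theorem reflectVec_mem_unitaryGroup {v : α → ℂ} (hv : ∑ a, ‖v a‖ ^ 2 = 1) :
    reflectVec v ∈ Matrix.unitaryGroup α ℂ := by
  have h1 : star v ⬝ᵥ v = 1 := by rw [star_dotProduct_self, hv]; simp
  have h2 : star (reflectVec v) = reflectVec v := by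
    rw [Matrix.star_eq_conjTranspose, reflectVec, Matrix.conjTranspose_sub,
      Matrix.conjTranspose_smul, Matrix.conjTranspose_vecMulVec, star_star,
      Matrix.conjTranspose_one]
    simp
  rw [Matrix.mem_unitaryGroup_iff, h2, reflectVec, sub_mul, mul_sub, mul_sub, smul_mul_smul_comm,
    Matrix.vecMulVec_mul_vecMulVec, h1]
  simp only [mul_one, one_mul, one_smul]
  module

/-- Conjugation by the loading operator turns a data-independent reflection into the reflection at
the loaded state, so the latter needs only one unloading and one loading. -/
theorem mul_reflectVec_mul {L : Matrix α α ℂ} (hL : L ∈ Matrix.unitaryGroup α ℂ) (v : α → ℂ) :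
    L * reflectVec v * star L = reflectVec (L *ᵥ v) := by
  rw [reflectVec, mul_sub, sub_mul, mul_one, Matrix.mem_unitaryGroup_iff.1 hL, reflectVec,
    mul_smul_comm, smul_mul_assoc, Matrix.mul_vecMulVec, Matrix.vecMulVec_mul, Matrix.star_mulVec,
    Matrix.star_eq_conjTranspose]

/-- The three-term recursion of the powers of a product of two reflections, one of them along the
vector on which they act. -/
theorem reflectVec_mul_sq_mulVec {v : α → ℂ} {R : Matrix α α ℂ} {μ : ℝ}
    (hv : ∑ a, ‖v a‖ ^ 2 = 1) (hR : R * R = 1) (hμ : star v ⬝ᵥ R *ᵥ v = μ) :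
    (reflectVec v * R) *ᵥ ((reflectVec v * R) *ᵥ v) + v =
      (2 * μ : ℂ) • ((reflectVec v * R) *ᵥ v) := by
  have h1 : star v ⬝ᵥ v = 1 := by rw [star_dotProduct_self, hv]; simp
  have h2 : R *ᵥ (R *ᵥ v) = v := by rw [Matrix.mulVec_mulVec, hR, Matrix.one_mulVec]
  -- With G the product, Gv = 2μv − Rv and G(Rv) = v. Geometrically this is Cayley–Hamilton for a
  -- rotation of trace 2μ in the span of v and Rv.
  simp only [← Matrix.mulVec_mulVec, reflectVec_mulVec, hμ, Matrix.mulVec_sub, Matrix.mulVec_smul,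
    h2, h1]
  module

end Vectors

/-! ### Measurement of a Hermitian operator -/

/-- In an eigenbasis H − μ is diagonal, so the mean square deviation of the measured eigenvalue from
μ is the squared residual of x as an eigenvector. U and D are chosen before μ and x, as a
data-independent measurement requires. -/
theorem exists_unitary_diagonalizing {ι : Type*} [Fintype ι] [DecidableEq ι] {H : Matrix ι ι ℂ}
    (hH : H.IsHermitian) :
    ∃ (U : Matrix.unitaryGroup ι ℂ) (D : ι → ℝ), ∀ (μ : ℝ) (x : ι → ℂ),
      ∑ j, (D j - μ) ^ 2 * ‖((U : Matrix ι ι ℂ) *ᵥ x) j‖ ^ 2 =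
        ∑ j, ‖(H *ᵥ x) j - μ * x j‖ ^ 2 := by
  refine ⟨star hH.eigenvectorUnitary, hH.eigenvalues, fun μ x => ?_⟩
  set V := (hH.eigenvectorUnitary : Matrix ι ι ℂ)
  have hV : star V * V = 1 := Matrix.mem_unitaryGroup_iff'.1 hH.eigenvectorUnitary.2
  have h1 : star V * H = Matrix.diagonal (RCLike.ofReal ∘ hH.eigenvalues) * star V := by
    conv_lhs => rw [hH.spectral_theorem]
    rw [Unitary.conjStarAlgAut_apply, ← mul_assoc, ← mul_assoc]
    change star V * V * _ * star V = _
    rw [hV, one_mul]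
  have h2 : ∀ j, (star V *ᵥ (H *ᵥ x - (μ : ℂ) • x)) j =
      ((hH.eigenvalues j - μ : ℝ) : ℂ) * (star V *ᵥ x) j := by
    intro j
    rw [Matrix.mulVec_sub, Matrix.mulVec_mulVec, h1, ← Matrix.mulVec_mulVec, Matrix.mulVec_smul,
      Pi.sub_apply, Matrix.mulVec_diagonal]
    simp [sub_mul]
  have h3 := sum_norm_sq_mulVec (star hH.eigenvectorUnitary).2 (H *ᵥ x - (μ : ℂ) • x)
  change ∑ j, ‖(star V *ᵥ (H *ᵥ x - (μ : ℂ) • x)) j‖ ^ 2 = _ at h3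
  simp only [h2, norm_mul, mul_pow, Complex.norm_real, Real.norm_eq_abs, sq_abs] at h3
  simpa using h3

/-! ### The tent-shaped clock state -/

/-- The adjacency matrix of a path, times `1 / 2`. -/
def pathMatrix (n : ℕ) : Matrix (Fin n) (Fin n) ℂ :=
  Matrix.of fun i j => (if (i : ℕ) + 1 = j then 1 / 2 else 0) + if (j : ℕ) + 1 = i then 1 / 2 else 0

theorem isHermitian_pathMatrix (n : ℕ) : (pathMatrix n).IsHermitian := by
  ext i j
  simp only [pathMatrix, Matrix.conjTranspose_apply, Matrix.of_apply, star_add]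
  rw [add_comm]
  congr 1 <;> split_ifs <;> simp

/-- The tent function that vanishes at `0` and at `4 q`. -/
def tent (q n : ℕ) : ℕ := min n (4 * q - n)

theorem abs_tent_succ_sub_le (q n : ℕ) : |(tent q (n + 1) : ℝ) - tent q n| ≤ 1 := by
  have h : |((tent q (n + 1) : ℕ) : ℤ) - (tent q n : ℕ)| ≤ 1 := by
    unfold tent; rw [abs_le]; omega
  exact_mod_cast h

/-- The normalization constant of the tent function. -/
def tentMass (q : ℕ) : ℝ := ∑ n : Fin (4 * q + 1), (tent q n : ℝ) ^ 2

/-- On the middle half [q, 3q) the tent has height at least q. -/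
theorem two_mul_pow_le_tentMass (q : ℕ) : 2 * (q : ℝ) ^ 3 ≤ tentMass q := by
  rw [tentMass, Fin.sum_univ_eq_sum_range (fun n => (tent q n : ℝ) ^ 2)]
  have hsub : Finset.Ico q (3 * q) ⊆ Finset.range (4 * q + 1) := by
    intro n; simp only [Finset.mem_Ico, Finset.mem_range]; omega
  refine le_trans ?_ (Finset.sum_le_sum_of_subset_of_nonneg hsub fun _ _ _ => sq_nonneg _)
  calc 2 * (q : ℝ) ^ 3 = ∑ n ∈ Finset.Ico q (3 * q), (q : ℝ) ^ 2 := by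
        rw [Finset.sum_const, Nat.card_Ico, show 3 * q - q = 2 * q by omega]
        simp; ring
    _ ≤ _ := by
        refine Finset.sum_le_sum fun n hn => ?_
        have : q ≤ tent q n := by
          rw [Finset.mem_Ico] at hn; unfold tent; omega
        gcongr

/-- The amplitudes of the clock state. -/
def tentAmp (q n : ℕ) : ℝ := tent q n / √(tentMass q)

theorem sum_tentAmp_sq {q : ℕ} (hq : 0 < q) : ∑ n : Fin (4 * q + 1), tentAmp q n ^ 2 = 1 := by
  have h : 0 < tentMass q := lt_of_lt_of_le (by positivity) (two_mul_pow_le_tentMass q)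
  simp only [tentAmp, div_pow, Real.sq_sqrt h.le]
  rw [← Finset.sum_div]
  exact div_self h.ne'

theorem pathMatrix_mulVec (n : ℕ) (x : ℕ → ℂ) (i : Fin n) :
    (pathMatrix n *ᵥ fun j => x j) i =
      1 / 2 * ((if (i : ℕ) + 1 < n then x (i + 1) else 0) +
        if 0 < (i : ℕ) then x (i - 1) else 0) := by
  simp only [Matrix.mulVec, dotProduct, pathMatrix, Matrix.of_apply, add_mul, ite_mul, zero_mul,
    Finset.sum_add_distrib]
  rw [mul_add]
  congr 1
  · split_ifs with h
    · rw [Finset.sum_eq_single (⟨i + 1, h⟩ : Fin n)]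
      · simp
      · intro b _ hb
        rw [if_neg]; intro h'; exact hb (Fin.ext h'.symm)
      · simp
    · rw [mul_zero]
      refine Finset.sum_eq_zero fun j _ => if_neg ?_
      have := j.2; omega
  · split_ifs with h
    · rw [Finset.sum_eq_single (⟨i - 1, by omega⟩ : Fin n)]
      · rw [if_pos]; simp only; omega
      · intro b _ hb
        rw [if_neg]; intro h'; apply hb; ext; simp only; omega
      · simp
    · rw [mul_zero]
      refine Finset.sum_eq_zero fun j _ => if_neg ?_
      omega

/-- The clock state makes a solution of a three-term recursion an approximate eigenvector of the
path matrix. -/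
theorem sum_norm_sq_pathMatrix_tent_sub_le {α : Type*} [Fintype α] {q : ℕ} (hq : 0 < q)
    {g : ℕ → α → ℂ} {μ : ℝ} (hnorm : ∀ n, ∑ a, ‖g n a‖ ^ 2 = 1)
    (hrec : ∀ n, g (n + 2) + g n = (2 * μ : ℂ) • g (n + 1)) :
    ∑ a, ∑ n : Fin (4 * q + 1),
      ‖(pathMatrix (4 * q + 1) *ᵥ fun n : Fin (4 * q + 1) => (tentAmp q n : ℂ) * g n a) n -
        μ * (tentAmp q n * g n a)‖ ^ 2 ≤ 3 / (q : ℝ) ^ 2 := by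
  have hmass : 0 < tentMass q := lt_of_lt_of_le (by positivity) (two_mul_pow_le_tentMass q)
  have hdiff : ∀ n, ‖(tentAmp q (n + 1) - tentAmp q n : ℂ)‖ ^ 2 ≤ 1 / tentMass q := by
    intro n
    rw [← Complex.ofReal_sub, Complex.norm_real, Real.norm_eq_abs, sq_abs, tentAmp, tentAmp,
      ← sub_div, div_pow, Real.sq_sqrt hmass.le]
    gcongr
    rw [sq_le_one_iff_abs_le_one]
    exact abs_tent_succ_sub_le q n
  -- Truncated subtraction makes the tent vanish just beyond the clock too, so the missing neighbour
  -- at the right end costs nothing.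
  have hend : tentAmp q (4 * q + 1) = 0 := by simp [tentAmp, tent]
  have hstart : tentAmp q 0 = 0 := by simp [tentAmp, tent]
  -- At n = 0 the term `g (n - 1)` is `g 0`; it only enlarges the bound and has norm 1 like the
  -- others.
  have hpt : ∀ (n : Fin (4 * q + 1)) (a : α),
      ‖(pathMatrix (4 * q + 1) *ᵥ fun n : Fin (4 * q + 1) => (tentAmp q n : ℂ) * g n a) n -
        μ * (tentAmp q n * g n a)‖ ^ 2 ≤
      1 / tentMass q * (1 / 2 * (‖g (n + 1) a‖ ^ 2 + ‖g (n - 1) a‖ ^ 2)) := by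
    intro n a
    rw [pathMatrix_mulVec (4 * q + 1) (fun n => (tentAmp q n : ℂ) * g n a) n]
    have h1 : (if (n : ℕ) + 1 < 4 * q + 1 then (tentAmp q (n + 1) : ℂ) * g (n + 1) a else 0) =
        (tentAmp q (n + 1) : ℂ) * g (n + 1) a := by
      split_ifs with h
      · rfl
      · have : (n : ℕ) + 1 = 4 * q + 1 := by have := n.2; omega
        rw [this, hend]; simp
    rw [h1]
    rcases n with ⟨_ | n, hn⟩
    · simp only [lt_self_iff_false, if_false, hstart, zero_add, add_zero]
      have := hdiff 0
      simp only [hstart, zero_add, Complex.ofReal_zero, sub_zero, Complex.norm_real,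
        Real.norm_eq_abs, sq_abs] at this
      simp only [Complex.ofReal_zero, zero_mul, mul_zero, sub_zero, norm_mul, mul_pow]
      rw [Complex.norm_real, Real.norm_eq_abs, sq_abs]
      have hm := one_div_pos.2 hmass
      norm_num at this hm ⊢
      nlinarith [mul_le_mul_of_nonneg_right this (sq_nonneg ‖g 1 a‖),
        mul_nonneg hm.le (sq_nonneg ‖g 0 a‖), mul_nonneg hm.le (sq_nonneg ‖g 1 a‖)]
    · have hr := congrFun (hrec n) a
      simp only [Pi.add_apply, Pi.smul_apply, smul_eq_mul] at hr
      change g (n + 1 + 1) a + g n a = _ at hr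
      simp only [Nat.succ_pos, if_true, Nat.add_sub_cancel]
      set u : ℂ := tentAmp q (n + 1 + 1) - tentAmp q (n + 1)
      set w : ℂ := tentAmp q (n + 1) - tentAmp q n
      -- The recursion removes the amplitude itself and leaves only its increments, each of size at
      -- most 1 / √(`tentMass q`).
      have e : 1 / 2 * ((tentAmp q (n + 1 + 1) : ℂ) * g (n + 1 + 1) a + tentAmp q n * g n a) -
          μ * (tentAmp q (n + 1) * g (n + 1) a) = 1 / 2 * (u * g (n + 1 + 1) a - w * g n a) := by
        linear_combination ((tentAmp q (n + 1) : ℂ) / 2) * hr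
      rw [e]
      have hu : ‖u * g (n + 1 + 1) a‖ ^ 2 ≤ 1 / tentMass q * ‖g (n + 1 + 1) a‖ ^ 2 := by
        rw [norm_mul, mul_pow]; gcongr; exact hdiff (n + 1)
      have hw : ‖w * g n a‖ ^ 2 ≤ 1 / tentMass q * ‖g n a‖ ^ 2 := by
        rw [norm_mul, mul_pow]; gcongr; exact hdiff n
      have ht := norm_sub_le (u * g (n + 1 + 1) a) (w * g n a)
      rw [norm_mul, mul_pow]
      norm_num
      have ht2 := pow_le_pow_left₀ (norm_nonneg _) ht 2
      have h4 := sq_nonneg (‖u * g (n + 1 + 1) a‖ - ‖w * g n a‖)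
      rw [one_div] at hu hw
      nlinarith
  rw [Finset.sum_comm]
  calc _ ≤ ∑ n : Fin (4 * q + 1), ∑ a,
        1 / tentMass q * (1 / 2 * (‖g (n + 1) a‖ ^ 2 + ‖g (n - 1) a‖ ^ 2)) :=
        Finset.sum_le_sum fun n _ => Finset.sum_le_sum fun a _ => hpt n a
    _ = (4 * q + 1) / tentMass q := by
        simp only [← Finset.mul_sum, Finset.sum_add_distrib, hnorm]
        simp
        field_simp; norm_num
    _ ≤ 5 * q / (2 * (q : ℝ) ^ 3) := by
        have : (1 : ℝ) ≤ q := by exact_mod_cast hq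
        gcongr
        · linarith
        · exact two_mul_pow_le_tentMass q
    _ ≤ _ := by
        rw [div_le_div_iff₀ (by positivity) (by positivity)]
        have : (0 : ℝ) < q := by exact_mod_cast hq
        nlinarith [pow_pos this 3]

/-! ### Amplification by repetition -/

/-- A value that lies within `δ` of more than half of the given estimates, if there is one. -/
def majority {n : ℕ} (δ : ℝ) (x : Fin n → ℝ) : ℝ :=
  open Classical in
  if h : ∃ v, n < 2 * (Finset.univ.filter fun s => |x s - v| ≤ δ).card then h.choose else 0

theorem abs_majority_sub_le {n : ℕ} {δ μ : ℝ} {x : Fin n → ℝ}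
    (h : n < 2 * (Finset.univ.filter fun s => |x s - μ| ≤ δ).card) :
    |majority δ x - μ| ≤ 2 * δ := by
  classical
  have hex : ∃ v, n < 2 * (Finset.univ.filter fun s => |x s - v| ≤ δ).card := ⟨μ, by convert h⟩
  have hv : majority δ x = hex.choose := by rw [majority, dif_pos]
  have hspec := hex.choose_spec
  rw [← hv] at hspec
  -- The chosen value need not be μ, but two sets of more than half of the runs share a run, which
  -- lies within δ of both.
  obtain ⟨s, hs⟩ : ((Finset.univ.filter fun s => |x s - majority δ x| ≤ δ) ∩
      Finset.univ.filter fun s => |x s - μ| ≤ δ).Nonempty := by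
    refine Finset.inter_nonempty_of_card_lt_card_add_card (Finset.subset_univ _)
      (Finset.subset_univ _) ?_
    simp only [Finset.card_univ, Fintype.card_fin]
    have h' : n < 2 * (Finset.univ.filter fun s => |x s - μ| ≤ δ).card := by convert h
    have h'' : n < 2 * (Finset.univ.filter fun s => |x s - majority δ x| ≤ δ).card := by
      convert hspec
    omega
  simp only [Finset.mem_inter, Finset.mem_filter, Finset.mem_univ, true_and] at hs
  have h3 : majority δ x - μ = (x s - μ) - (x s - majority δ x) := by ring
  rw [h3, two_mul]
  exact (abs_sub _ _).trans (add_le_add hs.2 hs.1)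

section Product

variable {ρ β : Type*} [Fintype ρ] [DecidableEq ρ] [Fintype β]

/-- Independence: the sum factors over the runs, with a factor at most θ for each run in B and 1 for
the others. -/
theorem sum_prod_le_pow {p : ρ → β → ℝ} (hp : ∀ r b, 0 ≤ p r b) (hsum : ∀ r, ∑ b, p r b = 1)
    {bad : ρ → β → Prop} [∀ r b, Decidable (bad r b)] {θ : ℝ}
    (hbad : ∀ r, ∑ b, p r b * (if bad r b then 1 else 0) ≤ θ) (B : Finset ρ) :
    ∑ o : ρ → β, (∏ r, p r (o r)) * (if ∀ r ∈ B, bad r (o r) then 1 else 0) ≤ θ ^ B.card := by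
  have h1 : ∀ o : ρ → β, (∏ r, p r (o r)) * (if ∀ r ∈ B, bad r (o r) then 1 else 0) =
      ∏ r, p r (o r) * (if r ∈ B then (if bad r (o r) then 1 else 0) else 1) := by
    intro o
    rw [Finset.prod_mul_distrib, Finset.prod_ite_mem, Finset.univ_inter]
    congr 1
    split_ifs with h
    · exact (Finset.prod_eq_one fun r hr => if_pos (h r hr)).symm
    · push Not at h
      obtain ⟨r, hr, h⟩ := h
      exact (Finset.prod_eq_zero hr (if_neg h)).symm
  simp only [h1]
  have h2 := Finset.prod_univ_sum (fun _ : ρ => (Finset.univ : Finset β))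
    fun r b => p r b * (if r ∈ B then (if bad r b then 1 else 0) else 1)
  rw [Fintype.piFinset_univ] at h2
  rw [← h2]
  calc _ ≤ ∏ r, if r ∈ B then θ else 1 := by
        refine Finset.prod_le_prod (fun r _ => Finset.sum_nonneg fun b _ => ?_) fun r _ => ?_
        · refine mul_nonneg (hp r b) ?_
          split_ifs <;> norm_num
        · split_ifs with h
          · exact hbad r
          · simp [hsum r]
    _ = _ := by rw [Finset.prod_ite_mem, Finset.univ_inter, Finset.prod_const]

end Product

/-- Chernoff-type bound: if every one of the independent runs `(e, s)` fails with probability at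
most `1 / 64`, then with high probability more than half of the runs succeed for every `e`. -/
theorem one_sub_le_sum_indicator {ι β : Type*} [Fintype ι] [DecidableEq ι] [Fintype β] {n : ℕ}
    {p : ι × Fin n → β → ℝ} (hp : ∀ r b, 0 ≤ p r b) (hsum : ∀ r, ∑ b, p r b = 1)
    {bad : ι × Fin n → β → Prop} [∀ r b, Decidable (bad r b)]
    (hbad : ∀ r, ∑ b, p r b * (if bad r b then 1 else 0) ≤ 1 / 64)
    {S : Set (ι × Fin n → β)}
    (hS : ∀ o, (∀ e, n < 2 * (Finset.univ.filter fun s => ¬ bad (e, s) (o (e, s))).card) → o ∈ S) :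
    1 - Fintype.card ι * (1 / 4) ^ n ≤ ∑ o, S.indicator (fun o => ∏ r, p r (o r)) o := by
  let emb : ι → Finset (Fin n) → Finset (ι × Fin n) := fun e B =>
    B.map ⟨fun s => (e, s), fun s t h => by simpa using h⟩
  have hw : ∀ o : ι × Fin n → β, 0 ≤ ∏ r, p r (o r) := fun o => Finset.prod_nonneg fun r _ => hp _ _
  have htot : ∑ o : ι × Fin n → β, ∏ r, p r (o r) = 1 := by
    have h2 := Finset.prod_univ_sum (fun _ : ι × Fin n => (Finset.univ : Finset β)) p
    rw [Fintype.piFinset_univ] at h2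
    rw [← h2]; exact Finset.prod_eq_one fun r _ => hsum r
  have hpt : ∀ o : ι × Fin n → β, ∏ r, p r (o r) ≤ S.indicator (fun o => ∏ r, p r (o r)) o +
      ∑ e, ∑ B ∈ Finset.univ.filter (fun B : Finset (Fin n) => n ≤ 2 * B.card),
        (∏ r, p r (o r)) * (if ∀ r ∈ emb e B, bad r (o r) then 1 else 0) := by
    intro o
    have hnn : ∀ e, ∀ B : Finset (Fin n), 0 ≤
        (∏ r, p r (o r)) * (if ∀ r ∈ emb e B, bad r (o r) then (1 : ℝ) else 0) := fun e B =>
      mul_nonneg (hw o) (by split_ifs <;> norm_num)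
    by_cases ho : o ∈ S
    · rw [Set.indicator_of_mem ho]
      exact le_add_of_nonneg_right (Finset.sum_nonneg fun e _ =>
        Finset.sum_nonneg fun B _ => hnn e B)
    · rw [Set.indicator_of_notMem ho, zero_add]
      have h := mt (hS o) ho
      push Not at h
      obtain ⟨e, he⟩ := h
      -- Outside S some e has a set of at least n / 2 failing runs; the union bound is over e and
      -- this set.
      set B : Finset (Fin n) := Finset.univ.filter fun s => bad (e, s) (o (e, s)) with hB
      have hcard : n ≤ 2 * B.card := by
        have := Finset.card_filter_add_card_filter_not (s := (Finset.univ : Finset (Fin n)))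
          (fun s => bad (e, s) (o (e, s)))
        rw [Finset.card_univ, Fintype.card_fin, ← hB] at this
        omega
      refine le_trans ?_ (Finset.single_le_sum (fun e _ => Finset.sum_nonneg fun B _ => hnn e B)
        (Finset.mem_univ e))
      refine le_trans ?_ (Finset.single_le_sum (fun B _ => hnn e B)
        (Finset.mem_filter.2 ⟨Finset.mem_univ B, hcard⟩))
      rw [if_pos, mul_one]
      intro r hr
      obtain ⟨s, hs, rfl⟩ := Finset.mem_map.1 hr
      exact (Finset.mem_filter.1 hs).2
  have h3 := Finset.sum_le_sum fun o (_ : o ∈ Finset.univ) => hpt o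
  rw [htot, Finset.sum_add_distrib] at h3
  have h4 : ∑ o : ι × Fin n → β, ∑ e, ∑ B ∈ Finset.univ.filter
      (fun B : Finset (Fin n) => n ≤ 2 * B.card),
        (∏ r, p r (o r)) * (if ∀ r ∈ emb e B, bad r (o r) then (1 : ℝ) else 0) ≤
      Fintype.card ι * (1 / 4) ^ n := by
    rw [Finset.sum_comm]
    simp only [Finset.sum_comm (s := (Finset.univ : Finset (ι × Fin n → β)))]
    calc _ ≤ ∑ e : ι, ∑ B ∈ Finset.univ.filter (fun B : Finset (Fin n) => n ≤ 2 * B.card),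
          (1 / 8 : ℝ) ^ n := by
          refine Finset.sum_le_sum fun e _ => Finset.sum_le_sum fun B hB => ?_
          refine (sum_prod_le_pow hp hsum hbad (emb e B)).trans ?_
          -- At least n / 2 failures have probability at most (1/8)ⁿ, which beats the 2ⁿ choices of
          -- B and leaves (1/4)ⁿ.
          rw [Finset.card_map, show (1 / 64 : ℝ) = (1 / 8) ^ 2 by norm_num, ← pow_mul]
          exact pow_le_pow_of_le_one (by norm_num) (by norm_num) (Finset.mem_filter.1 hB).2
      _ ≤ ∑ e : ι, (2 : ℝ) ^ n * (1 / 8) ^ n := by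
          refine Finset.sum_le_sum fun e _ => ?_
          rw [Finset.sum_const, nsmul_eq_mul]
          gcongr
          refine (Nat.cast_le.2 (Finset.card_filter_le _ _)).trans ?_
          simp
      _ = _ := by
          rw [Finset.sum_const, nsmul_eq_mul, ← mul_pow, Finset.card_univ]; norm_num
  linarith

/-! ### Operators controlled by a clock register -/

section Controlled

variable {α β τ : Type*} [Fintype α] [Fintype β] [Fintype τ] [DecidableEq τ]

/-- The vector on `α × (β × τ)` with the given components for the values of the last register. -/
def join (Ψ : τ → α × β → ℂ) : α × (β × τ) → ℂ := fun x => Ψ x.2.2 (x.1, x.2.1)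

/-- The operator that acts as `A t` if the last register has the value `t`. -/
def controlled (A : τ → Matrix (α × β) (α × β) ℂ) : Matrix (α × (β × τ)) (α × (β × τ)) ℂ :=
  Matrix.of fun x y => if x.2.2 = y.2.2 then A x.2.2 (x.1, x.2.1) (y.1, y.2.1) else 0

theorem controlled_mulVec_join (A : τ → Matrix (α × β) (α × β) ℂ) (Ψ : τ → α × β → ℂ) :
    controlled A *ᵥ join Ψ = join fun t => A t *ᵥ Ψ t := by
  ext x
  simp [controlled, join, Matrix.mulVec, dotProduct, Fintype.sum_prod_type]

theorem controlled_mul (A B : τ → Matrix (α × β) (α × β) ℂ) :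
    controlled A * controlled B = controlled fun t => A t * B t := by
  ext x y
  by_cases h : x.2.2 = y.2.2
  · simp [controlled, Matrix.mul_apply, Fintype.sum_prod_type, h]
  · simp [controlled, Matrix.mul_apply, Fintype.sum_prod_type, h]

variable [DecidableEq β]

/-- The oracles are available only without control: they act alike on all clock branches. -/
theorem kronecker_one_mulVec_join (P : Matrix α α ℂ) (Ψ : τ → α × β → ℂ) :
    (P ⊗ₖ (1 : Matrix (β × τ) (β × τ) ℂ)) *ᵥ join Ψ =
      join fun t => (P ⊗ₖ (1 : Matrix β β ℂ)) *ᵥ Ψ t := by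
  ext x
  simp [join, Matrix.mulVec, dotProduct, Fintype.sum_prod_type, Matrix.one_apply, Prod.ext_iff,
    ite_and]

variable [DecidableEq α]

theorem controlled_mem_unitaryGroup {A : τ → Matrix (α × β) (α × β) ℂ}
    (hA : ∀ t, A t ∈ Matrix.unitaryGroup (α × β) ℂ) :
    controlled A ∈ Matrix.unitaryGroup (α × (β × τ)) ℂ := by
  have h1 : star (controlled A) = controlled fun t => star (A t) := by
    ext x y
    simp only [controlled, Matrix.star_apply, Matrix.of_apply]
    by_cases h : x.2.2 = y.2.2
    · simp [h]
    · simp [h, Ne.symm h]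
  rw [Matrix.mem_unitaryGroup_iff, h1, controlled_mul]
  ext x y
  simp only [controlled, Matrix.of_apply, fun t => Matrix.mem_unitaryGroup_iff.1 (hA t),
    Matrix.one_apply, Prod.ext_iff]
  split_ifs <;> tauto

/-- The gate that applies `A t` if the last register has the value `t`. -/
def controlledGate (A : τ → Matrix.unitaryGroup (α × β) ℂ) :
    Matrix.unitaryGroup (α × (β × τ)) ℂ :=
  ⟨controlled fun t => A t, controlled_mem_unitaryGroup fun t => (A t).2⟩

theorem controlledGate_mulVec_join (A : τ → Matrix.unitaryGroup (α × β) ℂ) (Ψ : τ → α × β → ℂ) :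
    (controlledGate A).1 *ᵥ join Ψ = join fun t => (A t : Matrix (α × β) (α × β) ℂ) *ᵥ Ψ t :=
  controlled_mulVec_join _ _

theorem kronecker_mem_unitaryGroup {A : Matrix α α ℂ} {B : Matrix β β ℂ}
    (hA : A ∈ Matrix.unitaryGroup α ℂ) (hB : B ∈ Matrix.unitaryGroup β ℂ) :
    A ⊗ₖ B ∈ Matrix.unitaryGroup (α × β) ℂ :=
  Matrix.kronecker_mem_unitary hA hB

/-- The gate that applies `U` to the last register. -/
def clockGate (U : Matrix.unitaryGroup τ ℂ) : Matrix.unitaryGroup (α × (β × τ)) ℂ :=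
  ⟨(1 : Matrix α α ℂ) ⊗ₖ ((1 : Matrix β β ℂ) ⊗ₖ (U : Matrix τ τ ℂ)),
    kronecker_mem_unitaryGroup (one_mem _) (kronecker_mem_unitaryGroup (one_mem _) U.2)⟩

theorem clockGate_mulVec_join (U : Matrix.unitaryGroup τ ℂ) (Ψ : τ → α × β → ℂ)
    (x : α × (β × τ)) :
    ((clockGate U : Matrix.unitaryGroup (α × (β × τ)) ℂ).1 *ᵥ join Ψ) x =
      ((U : Matrix τ τ ℂ) *ᵥ fun t => Ψ t (x.1, x.2.1)) x.2.2 := by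
  simp [clockGate, join, Matrix.mulVec, dotProduct, Fintype.sum_prod_type, Matrix.one_apply]

theorem kronecker_one_mulVec_single {P : Matrix α α ℂ} {a a' : α}
    (h : P *ᵥ Pi.single a 1 = Pi.single a' 1) (b : β) :
    (P ⊗ₖ (1 : Matrix β β ℂ)) *ᵥ Pi.single (a, b) 1 = Pi.single (a', b) 1 := by
  rw [Matrix.mulVec_single_one] at h ⊢
  ext x
  have := congrFun h x.1
  simp only [Matrix.col_apply] at this
  simp [this, Matrix.one_apply, Pi.single_apply, Prod.ext_iff, ← ite_and, and_comm]

theorem one_kronecker_mulVec_single {P : Matrix β β ℂ} {b b' : β}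
    (h : P *ᵥ Pi.single b 1 = Pi.single b' 1) (a : α) :
    ((1 : Matrix α α ℂ) ⊗ₖ P) *ᵥ Pi.single (a, b) 1 = Pi.single (a, b') 1 := by
  rw [Matrix.mulVec_single_one] at h ⊢
  ext x
  have := congrFun h x.2
  simp only [Matrix.col_apply] at this
  simp [this, Matrix.one_apply, Pi.single_apply, Prod.ext_iff, ← ite_and, and_comm]

end Controlled

/-! ### Qubit reflections -/

section QubitReflection

variable {α : Type*} [DecidableEq α]

/-- The operator with diagonal `a` and with the entries `b` between the basis states that are
exchanged by `f`. -/
def flipMatrix (f : Equiv.Perm α) (a b : α → ℝ) : Matrix α α ℂ :=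
  Matrix.of fun x y => (if x = y then (a x : ℂ) else 0) + if f x = y then (b x : ℂ) else 0

theorem star_flipMatrix {f : Equiv.Perm α} {a b : α → ℝ} (hf : ∀ x, f (f x) = x)
    (hb : ∀ x, b (f x) = b x) : star (flipMatrix f a b) = flipMatrix f a b := by
  ext x y
  simp only [Matrix.star_apply, flipMatrix, Matrix.of_apply, star_add]
  have h1 : f x = y ↔ f y = x := ⟨fun h => by rw [← h, hf], fun h => by rw [← h, hf]⟩
  congr 1
  · by_cases h : x = y
    · subst h; simp
    · simp [h, Ne.symm h]
  · by_cases h : f x = y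
    · rw [if_pos h, if_pos (h1.1 h), ← h, hb]; simp
    · rw [if_neg h, if_neg (mt h1.2 h)]; simp

variable [Fintype α]

theorem flipMatrix_mulVec (f : Equiv.Perm α) (a b : α → ℝ) (v : α → ℂ) (x : α) :
    (flipMatrix f a b *ᵥ v) x = a x * v x + b x * v (f x) := by
  simp [flipMatrix, Matrix.mulVec, dotProduct, add_mul, Finset.sum_add_distrib]

/-- On a pair x, f x the operator is the block with rows (a, b) and (b, −a), a reflection when a² +
b² = 1. -/
theorem flipMatrix_mul_self {f : Equiv.Perm α} {a b : α → ℝ} (hf : ∀ x, f (f x) = x)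
    (ha : ∀ x, a (f x) = -a x) (hb : ∀ x, b (f x) = b x) (hab : ∀ x, a x ^ 2 + b x ^ 2 = 1) :
    flipMatrix f a b * flipMatrix f a b = 1 := by
  refine Matrix.ext_of_mulVec_single fun i => ?_
  rw [← Matrix.mulVec_mulVec, Matrix.one_mulVec]
  ext x
  simp only [flipMatrix_mulVec, hf, ha, hb]
  have h : (a x : ℂ) ^ 2 + (b x : ℂ) ^ 2 = 1 := by exact_mod_cast hab x
  push_cast
  linear_combination ((Pi.single i (1 : ℂ) : α → ℂ) x) * h

theorem flipMatrix_mem_unitaryGroup {f : Equiv.Perm α} {a b : α → ℝ} (hf : ∀ x, f (f x) = x)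
    (ha : ∀ x, a (f x) = -a x) (hb : ∀ x, b (f x) = b x) (hab : ∀ x, a x ^ 2 + b x ^ 2 = 1) :
    flipMatrix f a b ∈ Matrix.unitaryGroup α ℂ := by
  rw [Matrix.mem_unitaryGroup_iff, star_flipMatrix hf hb, flipMatrix_mul_self hf ha hb hab]

end QubitReflection

/-! ### Uniform superpositions -/

section Uniform

variable {α : Type*} [Fintype α] [DecidableEq α] {N : ℕ}

/-- The uniform superposition of the basis states `x k`. -/
def uniformState (x : Fin N → α) : α → ℂ :=
  ((1 / √(N : ℝ) : ℝ) : ℂ) • ∑ k, Pi.single (x k) (1 : ℂ)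

theorem mulVec_uniformState {L : Matrix α α ℂ} {x y : Fin N → α}
    (h : ∀ k, L *ᵥ Pi.single (x k) 1 = Pi.single (y k) 1) :
    L *ᵥ uniformState x = uniformState y := by
  rw [uniformState, Matrix.mulVec_smul, Matrix.mulVec_sum]
  simp only [h, uniformState]

theorem star_uniformState_dotProduct_mulVec (A : Matrix α α ℂ) (x : Fin N → α) :
    star (uniformState x) ⬝ᵥ A *ᵥ uniformState x = 1 / N * ∑ k, ∑ l, A (x k) (x l) := by
  have h1 : star (uniformState x) =
      ((1 / √(N : ℝ) : ℝ) : ℂ) • ∑ k, Pi.single (x k) (1 : ℂ) := by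
    ext a
    simp [uniformState, Pi.single_apply]
  rw [h1, uniformState, Matrix.mulVec_smul, Matrix.mulVec_sum, smul_dotProduct, dotProduct_smul,
    smul_smul, sum_dotProduct, ← Complex.ofReal_mul, ← sq, div_pow, one_pow,
    Real.sq_sqrt (Nat.cast_nonneg N), smul_eq_mul]
  push_cast
  congr 1
  refine Finset.sum_congr rfl fun k _ => ?_
  rw [dotProduct_sum]
  simp

theorem sum_norm_sq_uniformState (hN : 0 < N) {x : Fin N → α} (hx : Function.Injective x) :
    ∑ a, ‖uniformState x a‖ ^ 2 = 1 := by
  have h := star_uniformState_dotProduct_mulVec 1 x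
  rw [Matrix.one_mulVec, star_dotProduct_self] at h
  have h2 : (1 / N * ∑ k, ∑ l, (1 : Matrix α α ℂ) (x k) (x l) : ℂ) = ((1 : ℝ) : ℂ) := by
    simp [Matrix.one_apply, hx.eq_iff, hN.ne']
  rw [h2] at h
  exact_mod_cast h

/-- The off-diagonal entries lead out of the support of the state, so only the average of the
diagonal survives. -/
theorem star_uniformState_dotProduct_flipMatrix {f : Equiv.Perm α} {a b : α → ℝ} {x : Fin N → α}
    (hx : Function.Injective x) (hfx : ∀ k l, f (x k) ≠ x l) :
    star (uniformState x) ⬝ᵥ flipMatrix f a b *ᵥ uniformState x =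
      ((1 / N * ∑ k, a (x k) : ℝ) : ℂ) := by
  rw [star_uniformState_dotProduct_mulVec]
  simp [flipMatrix, hx.eq_iff, hfx]

end Uniform

/-! ### The estimation circuit -/

section Circuit

variable {d N m : ℕ}

/-- The query registers. -/
abbrev Query (d N m : ℕ) : Type := Fin d × Fin N × Bits m

/-- The query registers, a register for a copy of a value, and a qubit. -/
abbrev Work (d N m : ℕ) : Type := Query d N m × (Bits m × Bool)

/-- A query of the second value of an entry, or its inverse: the design matrix for the entries
`W i j` and the objective variable for the entries `z i`. -/
def secondQuery {ω : Type} [Fintype ω] [DecidableEq ω] (isX inverse : Bool) : Step d N m ω :=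
  match isX, inverse with
  | true, false => .useX
  | true, true => .useXInv
  | false, false => .useY
  | false, true => .useYInv

/-- The operator of the second query on the query registers. -/
def secondOp (Px : Matrix (Query d N m) (Query d N m) ℂ)
    (Py : Matrix (Fin N × Bits m) (Fin N × Bits m) ℂ) (isX : Bool) :
    Matrix (Query d N m) (Query d N m) ℂ :=
  if isX then Px else (1 : Matrix (Fin d) (Fin d) ℂ) ⊗ₖ Py

theorem op_secondQuery {ω : Type} [Fintype ω] [DecidableEq ω]
    (Px : Matrix (Query d N m) (Query d N m) ℂ)
    (Py : Matrix (Fin N × Bits m) (Fin N × Bits m) ℂ) (isX : Bool) :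
    (secondQuery isX false : Step d N m ω).op Px Py = secondOp Px Py isX ⊗ₖ (1 : Matrix ω ω ℂ) := by
  cases isX <;> simp [secondQuery, secondOp, Step.op]

theorem op_secondQuery_inverse {ω : Type} [Fintype ω] [DecidableEq ω]
    (Px : Matrix (Query d N m) (Query d N m) ℂ)
    (Py : Matrix (Fin N × Bits m) (Fin N × Bits m) ℂ) (isX : Bool) :
    (secondQuery isX true : Step d N m ω).op Px Py =
      star (secondOp Px Py isX) ⊗ₖ (1 : Matrix ω ω ℂ) := by
  cases isX <;>
    simp [secondQuery, secondOp, Step.op, Matrix.star_eq_conjTranspose,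
      Matrix.conjTranspose_kronecker]

theorem secondOp_mem_unitaryGroup {Px : Matrix (Query d N m) (Query d N m) ℂ}
    {Py : Matrix (Fin N × Bits m) (Fin N × Bits m) ℂ}
    (hPx : Px ∈ Matrix.unitaryGroup (Query d N m) ℂ)
    (hPy : Py ∈ Matrix.unitaryGroup (Fin N × Bits m) ℂ) (isX : Bool) :
    secondOp Px Py isX ∈ Matrix.unitaryGroup (Query d N m) ℂ := by
  cases isX
  · exact kronecker_mem_unitaryGroup (one_mem _) hPy
  · exact hPx

/-- The steps that load two values. -/
def loadSteps (τ : Type) [Fintype τ] [DecidableEq τ] (isX : Bool)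
    (S : Matrix.unitaryGroup (Work d N m) ℂ) : List (Step d N m ((Bits m × Bool) × τ)) :=
  [.useX, .gate (controlledGate fun _ => S), secondQuery isX false]

/-- The inverse of `loadSteps`. -/
def unloadSteps (τ : Type) [Fintype τ] [DecidableEq τ] (isX : Bool)
    (S : Matrix.unitaryGroup (Work d N m) ℂ) : List (Step d N m ((Bits m × Bool) × τ)) :=
  [secondQuery isX true, .gate (controlledGate fun _ => star S), .useXInv]

/-- The operator of `loadSteps` on the registers without the clock. -/
def loadOp (Px : Matrix (Query d N m) (Query d N m) ℂ)
    (Py : Matrix (Fin N × Bits m) (Fin N × Bits m) ℂ) (isX : Bool)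
    (S : Matrix.unitaryGroup (Work d N m) ℂ) : Matrix (Work d N m) (Work d N m) ℂ :=
  (secondOp Px Py isX ⊗ₖ (1 : Matrix (Bits m × Bool) (Bits m × Bool) ℂ)) * S *
    (Px ⊗ₖ (1 : Matrix (Bits m × Bool) (Bits m × Bool) ℂ))

theorem loadOp_mem_unitaryGroup {Px : Matrix (Query d N m) (Query d N m) ℂ}
    {Py : Matrix (Fin N × Bits m) (Fin N × Bits m) ℂ}
    (hPx : Px ∈ Matrix.unitaryGroup (Query d N m) ℂ)
    (hPy : Py ∈ Matrix.unitaryGroup (Fin N × Bits m) ℂ) (isX : Bool)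
    (S : Matrix.unitaryGroup (Work d N m) ℂ) :
    loadOp Px Py isX S ∈ Matrix.unitaryGroup (Work d N m) ℂ :=
  mul_mem (mul_mem (kronecker_mem_unitaryGroup (secondOp_mem_unitaryGroup hPx hPy isX)
    (one_mem _)) S.2) (kronecker_mem_unitaryGroup hPx (one_mem _))

/-- Execution of a list of steps. -/
def run {ω : Type} [Fintype ω] [DecidableEq ω] (Px : Matrix (Query d N m) (Query d N m) ℂ)
    (Py : Matrix (Fin N × Bits m) (Fin N × Bits m) ℂ) (l : List (Step d N m ω))
    (ψ : Basis d N m ω → ℂ) : Basis d N m ω → ℂ :=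
  l.foldl (fun ψ s => s.op Px Py *ᵥ ψ) ψ

theorem run_append {ω : Type} [Fintype ω] [DecidableEq ω]
    (Px : Matrix (Query d N m) (Query d N m) ℂ)
    (Py : Matrix (Fin N × Bits m) (Fin N × Bits m) ℂ) (l l' : List (Step d N m ω))
    (ψ : Basis d N m ω → ℂ) : run Px Py (l ++ l') ψ = run Px Py l' (run Px Py l ψ) :=
  List.foldl_append

theorem run_cons {ω : Type} [Fintype ω] [DecidableEq ω]
    (Px : Matrix (Query d N m) (Query d N m) ℂ)
    (Py : Matrix (Fin N × Bits m) (Fin N × Bits m) ℂ) (s : Step d N m ω) (l : List (Step d N m ω))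
    (ψ : Basis d N m ω → ℂ) : run Px Py (s :: l) ψ = run Px Py l (s.op Px Py *ᵥ ψ) := rfl

theorem run_nil {ω : Type} [Fintype ω] [DecidableEq ω]
    (Px : Matrix (Query d N m) (Query d N m) ℂ)
    (Py : Matrix (Fin N × Bits m) (Fin N × Bits m) ℂ)
    (ψ : Basis d N m ω → ℂ) : run Px Py [] ψ = ψ := rfl

theorem op_mem_unitaryGroup {ω : Type} [Fintype ω] [DecidableEq ω]
    {Px : Matrix (Query d N m) (Query d N m) ℂ} {Py : Matrix (Fin N × Bits m) (Fin N × Bits m) ℂ}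
    (hPx : Px ∈ Matrix.unitaryGroup (Query d N m) ℂ)
    (hPy : Py ∈ Matrix.unitaryGroup (Fin N × Bits m) ℂ) (s : Step d N m ω) :
    s.op Px Py ∈ Matrix.unitaryGroup (Basis d N m ω) ℂ := by
  cases s with
  | gate U => exact U.2
  | useX => exact kronecker_mem_unitaryGroup hPx (one_mem _)
  | useXInv => exact kronecker_mem_unitaryGroup (Unitary.star_mem hPx) (one_mem _)
  | useY =>
    exact kronecker_mem_unitaryGroup (kronecker_mem_unitaryGroup (one_mem _) hPy) (one_mem _)
  | useYInv =>
    exact kronecker_mem_unitaryGroup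
      (kronecker_mem_unitaryGroup (one_mem _) (Unitary.star_mem hPy)) (one_mem _)

theorem sum_norm_sq_run {ω : Type} [Fintype ω] [DecidableEq ω]
    {Px : Matrix (Query d N m) (Query d N m) ℂ} {Py : Matrix (Fin N × Bits m) (Fin N × Bits m) ℂ}
    (hPx : Px ∈ Matrix.unitaryGroup (Query d N m) ℂ)
    (hPy : Py ∈ Matrix.unitaryGroup (Fin N × Bits m) ℂ) (l : List (Step d N m ω))
    (ψ : Basis d N m ω → ℂ) : ∑ b, ‖run Px Py l ψ b‖ ^ 2 = ∑ b, ‖ψ b‖ ^ 2 := by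
  induction l generalizing ψ with
  | nil => rfl
  | cons s l ih => rw [run_cons, ih, sum_norm_sq_mulVec (op_mem_unitaryGroup hPx hPy s)]

section

variable {τ : Type} [Fintype τ] [DecidableEq τ] (Px : Matrix (Query d N m) (Query d N m) ℂ)
  (Py : Matrix (Fin N × Bits m) (Fin N × Bits m) ℂ)

theorem run_loadSteps (isX : Bool) (S : Matrix.unitaryGroup (Work d N m) ℂ)
    (Ψ : τ → Work d N m → ℂ) :
    run Px Py (loadSteps τ isX S) (join Ψ) = join fun t => loadOp Px Py isX S *ᵥ Ψ t := by
  simp only [loadSteps, run_cons, run_nil, op_secondQuery]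
  simp only [Step.op, kronecker_one_mulVec_join, controlledGate_mulVec_join]
  simp only [loadOp, Matrix.mulVec_mulVec, mul_assoc]

theorem run_unloadSteps (isX : Bool) (S : Matrix.unitaryGroup (Work d N m) ℂ)
    (Ψ : τ → Work d N m → ℂ) :
    run Px Py (unloadSteps τ isX S) (join Ψ) = join fun t => star (loadOp Px Py isX S) *ᵥ Ψ t := by
  simp only [unloadSteps, run_cons, run_nil, op_secondQuery_inverse]
  simp only [Step.op, kronecker_one_mulVec_join, controlledGate_mulVec_join]
  simp only [loadOp, Matrix.mulVec_mulVec, star_mul, Matrix.star_eq_conjTranspose,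
    Matrix.conjTranspose_kronecker, Matrix.conjTranspose_one, mul_assoc, Unitary.coe_star]

end

/-- One step of the walk: the qubit reflection `R` and the reflection `F` at the loaded state,
both performed only if the clock is larger than `n`. -/
def walkSteps (L : ℕ) (isX : Bool) (S R F : Matrix.unitaryGroup (Work d N m) ℂ) (n : ℕ) :
    List (Step d N m ((Bits m × Bool) × Fin L)) :=
  .gate (controlledGate fun t => if n < (t : ℕ) then R else 1) :: (unloadSteps (Fin L) isX S ++
    .gate (controlledGate fun t => if n < (t : ℕ) then F else 1) :: loadSteps (Fin L) isX S)

/-- The complete circuit: preparation, loading, `4 q` steps of the walk, and a final gate. -/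
def estimationCircuit (q : ℕ) (isX : Bool)
    (P : Matrix.unitaryGroup (Basis d N m ((Bits m × Bool) × Fin (4 * q + 1))) ℂ)
    (S R F : Matrix.unitaryGroup (Work d N m) ℂ)
    (U : Matrix.unitaryGroup (Fin (4 * q + 1)) ℂ) :
    List (Step d N m ((Bits m × Bool) × Fin (4 * q + 1))) :=
  .gate P :: (loadSteps _ isX S ++ ((List.range (4 * q)).flatMap (walkSteps _ isX S R F) ++
    [.gate (clockGate U)]))

theorem run_walkSteps {L : ℕ} {Px : Matrix (Query d N m) (Query d N m) ℂ}
    {Py : Matrix (Fin N × Bits m) (Fin N × Bits m) ℂ}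
    (hPx : Px ∈ Matrix.unitaryGroup (Query d N m) ℂ)
    (hPy : Py ∈ Matrix.unitaryGroup (Fin N × Bits m) ℂ) (isX : Bool)
    (S R : Matrix.unitaryGroup (Work d N m) ℂ) {F : Matrix.unitaryGroup (Work d N m) ℂ}
    {φ : Work d N m → ℂ} (hF : (F : Matrix (Work d N m) (Work d N m) ℂ) = reflectVec φ) (n : ℕ)
    (Ψ : Fin L → Work d N m → ℂ) :
    run Px Py (walkSteps L isX S R F n) (join Ψ) =
      join fun t : Fin L => if n < (t : ℕ) then
        (reflectVec (loadOp Px Py isX S *ᵥ φ) * (R : Matrix (Work d N m) (Work d N m) ℂ)) *ᵥ Ψ t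
        else Ψ t := by
  have hL := loadOp_mem_unitaryGroup hPx hPy isX S
  rw [walkSteps, run_cons, Step.op, controlledGate_mulVec_join, run_append, run_unloadSteps,
    run_cons, Step.op, controlledGate_mulVec_join, run_loadSteps]
  congr 1
  funext t
  split_ifs with h
  · rw [Matrix.mulVec_mulVec, Matrix.mulVec_mulVec, Matrix.mulVec_mulVec,
      ← mul_reflectVec_mul hL, hF]
  -- On the inactive branches the uncontrolled unloading and loading cancel; hence controlling the
  -- two reflections suffices.
  · simp only [OneMemClass.coe_one, Matrix.one_mulVec]
    rw [Matrix.mulVec_mulVec, Matrix.mem_unitaryGroup_iff.1 hL, Matrix.one_mulVec]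

/-- Step number n acts on the branch t only if n < t, so each branch stops after t steps. -/
theorem run_flatMap_walkSteps {L : ℕ} {Px : Matrix (Query d N m) (Query d N m) ℂ}
    {Py : Matrix (Fin N × Bits m) (Fin N × Bits m) ℂ}
    (hPx : Px ∈ Matrix.unitaryGroup (Query d N m) ℂ)
    (hPy : Py ∈ Matrix.unitaryGroup (Fin N × Bits m) ℂ) (isX : Bool)
    (S R : Matrix.unitaryGroup (Work d N m) ℂ) {F : Matrix.unitaryGroup (Work d N m) ℂ}
    {φ : Work d N m → ℂ} (hF : (F : Matrix (Work d N m) (Work d N m) ℂ) = reflectVec φ) (n : ℕ)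
    (Ψ : Fin L → Work d N m → ℂ) :
    run Px Py ((List.range n).flatMap (walkSteps L isX S R F)) (join Ψ) =
      join fun t : Fin L => (reflectVec (loadOp Px Py isX S *ᵥ φ) *
        (R : Matrix (Work d N m) (Work d N m) ℂ)) ^ (min n (t : ℕ)) *ᵥ Ψ t := by
  induction n with
  | zero => simp [run_nil]
  | succ n ih =>
    rw [List.range_succ, List.flatMap_append, run_append, ih, List.flatMap_singleton,
      run_walkSteps hPx hPy isX S R hF]
    congr 1
    funext t
    split_ifs with h
    · rw [Matrix.mulVec_mulVec, ← pow_succ', show min n (t : ℕ) + 1 = min (n + 1) t by omega]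
    · rw [show min n (t : ℕ) = min (n + 1) t by omega]

/-- The measured clock value determines the expectation value `μ` of the qubit reflection with a
mean square error of order `1 / q ^ 2`. -/
theorem sum_sq_mul_norm_sq_run_estimationCircuit_le {q : ℕ} (hq : 0 < q)
    {Px : Matrix (Query d N m) (Query d N m) ℂ} {Py : Matrix (Fin N × Bits m) (Fin N × Bits m) ℂ}
    (hPx : Px ∈ Matrix.unitaryGroup (Query d N m) ℂ)
    (hPy : Py ∈ Matrix.unitaryGroup (Fin N × Bits m) ℂ) (isX : Bool)
    {P : Matrix.unitaryGroup (Basis d N m ((Bits m × Bool) × Fin (4 * q + 1))) ℂ}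
    {S R F : Matrix.unitaryGroup (Work d N m) ℂ} {U : Matrix.unitaryGroup (Fin (4 * q + 1)) ℂ}
    {s : Basis d N m ((Bits m × Bool) × Fin (4 * q + 1))} {φ : Work d N m → ℂ} {μ : ℝ}
    {D : Fin (4 * q + 1) → ℝ} (hφ : ∑ a, ‖φ a‖ ^ 2 = 1)
    (hP : (P : Matrix _ _ ℂ) *ᵥ ket s =
      join fun t : Fin (4 * q + 1) => (tentAmp q t : ℂ) • φ)
    (hF : (F : Matrix (Work d N m) (Work d N m) ℂ) = reflectVec φ)
    (hR : (R : Matrix (Work d N m) (Work d N m) ℂ) * R = 1)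
    (hμ : star (loadOp Px Py isX S *ᵥ φ) ⬝ᵥ (R : Matrix (Work d N m) (Work d N m) ℂ) *ᵥ
      (loadOp Px Py isX S *ᵥ φ) = μ)
    (hU : ∀ (μ : ℝ) (x : Fin (4 * q + 1) → ℂ),
      ∑ j, (D j - μ) ^ 2 * ‖((U : Matrix _ _ ℂ) *ᵥ x) j‖ ^ 2 =
        ∑ j, ‖(pathMatrix (4 * q + 1) *ᵥ x) j - μ * x j‖ ^ 2) :
    ∑ b, (D b.2.2 - μ) ^ 2 * ‖run Px Py (estimationCircuit q isX P S R F U) (ket s) b‖ ^ 2 ≤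
      3 / (q : ℝ) ^ 2 := by
  have hL := loadOp_mem_unitaryGroup hPx hPy isX S
  set ψ := loadOp Px Py isX S *ᵥ φ with hψ
  have hψ1 : ∑ a, ‖ψ a‖ ^ 2 = 1 := by rw [hψ, sum_norm_sq_mulVec hL, hφ]
  set G : Matrix (Work d N m) (Work d N m) ℂ := reflectVec ψ * R with hG
  have hGu : G ∈ Matrix.unitaryGroup (Work d N m) ℂ := mul_mem (reflectVec_mem_unitaryGroup hψ1) R.2
  set g : ℕ → Work d N m → ℂ := fun n => G ^ n *ᵥ ψ with hg
  have hnorm : ∀ n, ∑ a, ‖g n a‖ ^ 2 = 1 := fun n => by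
    rw [hg]; simp only; rw [sum_norm_sq_mulVec (pow_mem hGu n), hψ1]
  have hrec : ∀ n, g (n + 2) + g n = (2 * μ : ℂ) • g (n + 1) := by
    intro n
    have h := congrArg (fun v => G ^ n *ᵥ v) (reflectVec_mul_sq_mulVec hψ1 hR hμ)
    simp only [← hG, Matrix.mulVec_add, Matrix.mulVec_smul, Matrix.mulVec_mulVec] at h
    simp only [hg]
    rw [pow_succ G n, ← h, pow_succ, pow_succ, mul_assoc]
  have hrun : ∀ b, run Px Py (estimationCircuit q isX P S R F U) (ket s) b =
      ((U : Matrix _ _ ℂ) *ᵥ fun t : Fin (4 * q + 1) => (tentAmp q t : ℂ) * g t (b.1, b.2.1))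
        b.2.2 := by
    intro b
    rw [estimationCircuit, run_cons, Step.op, hP, run_append, run_loadSteps, run_append,
      run_flatMap_walkSteps hPx hPy isX S R hF, run_cons, run_nil, Step.op, clockGate_mulVec_join]
    congr 2
    funext t
    -- All clock values are at most 4q, so after 4q steps the branch t carries exactly the t-th
    -- power.
    rw [min_eq_right (by have := t.2; omega), Matrix.mulVec_smul, Matrix.mulVec_smul]
    simp [hg, hG, hψ]
  simp only [hrun]
  refine le_trans (le_of_eq ?_) (sum_norm_sq_pathMatrix_tent_sub_le hq hnorm hrec)
  rw [← (Equiv.prodAssoc (Query d N m) (Bits m × Bool) (Fin (4 * q + 1))).sum_comp,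
    Fintype.sum_prod_type]
  refine Finset.sum_congr rfl fun a _ => ?_
  exact hU μ fun t => (tentAmp q t : ℂ) * g t a

/-! ### Query counts -/

theorem sum_costX_estimationCircuit_le (q : ℕ) (isX : Bool)
    (P : Matrix.unitaryGroup (Basis d N m ((Bits m × Bool) × Fin (4 * q + 1))) ℂ)
    (S R F : Matrix.unitaryGroup (Work d N m) ℂ) (U : Matrix.unitaryGroup (Fin (4 * q + 1)) ℂ) :
    ((estimationCircuit q isX P S R F U).map Step.costX).sum ≤ 16 * q + 2 := by
  -- Unloading and loading take two queries each; 4q steps and the initial loading give 16q + 2.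
  have h : ∀ n, ((walkSteps (4 * q + 1) isX S R F n).map Step.costX).sum ≤ 4 := by
    intro n; cases isX <;> simp [walkSteps, loadSteps, unloadSteps, secondQuery, Step.costX]
  have h2 : ∀ k, (((List.range k).flatMap (walkSteps (4 * q + 1) isX S R F)).map
      Step.costX).sum ≤ 4 * k := by
    intro k
    induction k with
    | zero => simp
    | succ k ih =>
      rw [List.range_succ, List.flatMap_append, List.flatMap_singleton, List.map_append,
        List.sum_append]
      have := h k; omega
  have h3 : ((loadSteps (Fin (4 * q + 1)) isX S).map Step.costX).sum ≤ 2 := by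
    cases isX <;> simp [loadSteps, secondQuery, Step.costX]
  have h4 := h2 (4 * q)
  simp only [estimationCircuit, List.map_cons, List.map_append, List.sum_cons, List.sum_append,
    Step.costX, List.map_nil, List.sum_nil]
  omega

theorem sum_costY_estimationCircuit_le (q : ℕ) (isX : Bool)
    (P : Matrix.unitaryGroup (Basis d N m ((Bits m × Bool) × Fin (4 * q + 1))) ℂ)
    (S R F : Matrix.unitaryGroup (Work d N m) ℂ) (U : Matrix.unitaryGroup (Fin (4 * q + 1)) ℂ) :
    ((estimationCircuit q isX P S R F U).map Step.costY).sum ≤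
      if isX then 0 else 8 * q + 1 := by
  have h : ∀ n, ((walkSteps (4 * q + 1) isX S R F n).map Step.costY).sum ≤
      if isX then 0 else 2 := by
    intro n; cases isX <;> simp [walkSteps, loadSteps, unloadSteps, secondQuery, Step.costY]
  have h2 : ∀ k, (((List.range k).flatMap (walkSteps (4 * q + 1) isX S R F)).map
      Step.costY).sum ≤ if isX then 0 else 2 * k := by
    intro k
    induction k with
    | zero => simp
    | succ k ih =>
      rw [List.range_succ, List.flatMap_append, List.flatMap_singleton, List.map_append,
        List.sum_append]
      have := h k
      cases isX <;> simp at * <;> omega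
  have h3 : ((loadSteps (Fin (4 * q + 1)) isX S).map Step.costY).sum ≤ if isX then 0 else 1 := by
    cases isX <;> simp [loadSteps, secondQuery, Step.costY]
  have h4 := h2 (4 * q)
  simp only [estimationCircuit, List.map_cons, List.map_append, List.sum_cons, List.sum_append,
    Step.costY, List.map_nil, List.sum_nil]
  cases isX <;> simp at * <;> omega

end Circuit

/-! ### The algorithm -/

section Algorithm

variable {d N m : ℕ}

/-- The permutation that stores a copy of the loaded value and exchanges the indices `i`, `j`. -/
def storeValue (i j : Fin d) : Equiv.Perm (Work d N m) where
  -- Exchanging the two value registers returns the zero string to the query register, since the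
  -- oracles are specified only there.
  toFun x := ((Equiv.swap i j x.1.1, x.1.2.1, x.2.1), (x.1.2.2, x.2.2))
  invFun x := ((Equiv.swap i j x.1.1, x.1.2.1, x.2.1), (x.1.2.2, x.2.2))
  left_inv x := by simp
  right_inv x := by simp

/-- The permutation that flips the qubit. -/
def flipQubit : Equiv.Perm (Work d N m) where
  toFun x := (x.1, (x.2.1, !x.2.2))
  invFun x := (x.1, (x.2.1, !x.2.2))
  left_inv x := by simp
  right_inv x := by simp

/-- The product of the two loaded values, truncated to `[-1, 1]`. -/
def truncatedProduct (val : Bits m → ℝ) (x : Work d N m) : ℝ :=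
  -- Bit strings may represent arbitrary reals; the truncation makes the reflection unitary on all
  -- of them and is inactive on admissible data.
  max (-1) (min 1 (val x.2.1 * val x.1.2.2))

theorem truncatedProduct_sq_le_one (val : Bits m → ℝ) (x : Work d N m) :
    truncatedProduct val x ^ 2 ≤ 1 := by
  rw [sq_le_one_iff_abs_le_one, abs_le]
  exact ⟨le_max_left _ _, max_le (by norm_num) (min_le_left _ _)⟩

/-- The diagonal of the qubit reflection. -/
def reflectionDiag (val : Bits m → ℝ) (x : Work d N m) : ℝ :=
  if x.2.2 then -truncatedProduct val x else truncatedProduct val x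

/-- The reflection of the qubit whose expectation value in the state `|0⟩` is the product of the
two loaded values. -/
def valueReflection (val : Bits m → ℝ) : Matrix.unitaryGroup (Work d N m) ℂ :=
  ⟨flipMatrix flipQubit (reflectionDiag val) fun x => √(1 - truncatedProduct val x ^ 2),
    flipMatrix_mem_unitaryGroup (by simp [flipQubit])
      (fun x => by cases h : x.2.2 <;> simp [flipQubit, reflectionDiag, truncatedProduct, h])
      (fun x => rfl) fun x => by
        rw [Real.sq_sqrt (sub_nonneg.2 (truncatedProduct_sq_le_one val x)), reflectionDiag]
        split_ifs <;> ring⟩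

theorem valueReflection_mul_self (val : Bits m → ℝ) :
    (valueReflection val : Matrix.unitaryGroup (Work d N m) ℂ).1 *
      (valueReflection val : Matrix.unitaryGroup (Work d N m) ℂ).1 = 1 :=
  flipMatrix_mul_self (by simp [flipQubit])
    (fun x => by cases h : x.2.2 <;> simp [flipQubit, reflectionDiag, truncatedProduct, h])
    (fun x => rfl) fun x => by
      rw [Real.sq_sqrt (sub_nonneg.2 (truncatedProduct_sq_le_one val x)), reflectionDiag]
      split_ifs <;> ring

/-- The numbers to be estimated: the entries of `W` and of `z`. -/
def entry (X : Matrix (Fin N) (Fin d) ℝ) (y : Fin N → ℝ) (i : Fin d) : Option (Fin d) → ℝ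
  | some j => gram X i j
  | none => moment X y i

/-- The second factor in the sum that defines an entry. -/
def secondValue (X : Matrix (Fin N) (Fin d) ℝ) (y : Fin N → ℝ) (k : Fin N) : Option (Fin d) → ℝ
  | some j => X k j
  | none => y k

theorem entry_eq_sum (X : Matrix (Fin N) (Fin d) ℝ) (y : Fin N → ℝ) (i : Fin d)
    (o : Option (Fin d)) :
    entry X y i o = 1 / N * ∑ k, X k i * secondValue X y k o := by
  cases o <;> simp [entry, secondValue, gram, moment, Matrix.mul_apply, Matrix.mulVec, dotProduct]

theorem exists_secondOp_mulVec_single {val : Bits m → ℝ} {X : Matrix (Fin N) (Fin d) ℝ}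
    {y : Fin N → ℝ} {Px : Matrix (Query d N m) (Query d N m) ℂ}
    {Py : Matrix (Fin N × Bits m) (Fin N × Bits m) ℂ} (hPx : IsOracleX val X Px)
    (hPy : IsOracleY val y Py) (i : Fin d) (o : Option (Fin d)) (k : Fin N) :
    ∃ v : Bits m, val v = secondValue X y k o ∧
      secondOp Px Py o.isSome *ᵥ Pi.single (o.getD i, k, zeroBits m) 1 =
        Pi.single (o.getD i, k, v) 1 := by
  cases o with
  | some j => exact hPx.2 j k
  | none =>
    obtain ⟨v, hv, h⟩ := hPy.2 k
    exact ⟨v, hv, one_kronecker_mulVec_single h i⟩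

/-- The state before loading, without the clock. -/
def unloadedState (i : Fin d) : Work d N m → ℂ :=
  uniformState fun k : Fin N => ((i, k, zeroBits m), (zeroBits m, false))

theorem sum_norm_sq_unloadedState (hN : 0 < N) (i : Fin d) :
    ∑ a, ‖(unloadedState i : Work d N m → ℂ) a‖ ^ 2 = 1 :=
  sum_norm_sq_uniformState hN fun k l h => by simpa using h

theorem star_loaded_dotProduct_valueReflection {val : Bits m → ℝ} {X : Matrix (Fin N) (Fin d) ℝ}
    {y : Fin N → ℝ} {Px : Matrix (Query d N m) (Query d N m) ℂ}
    {Py : Matrix (Fin N × Bits m) (Fin N × Bits m) ℂ} (hPx : IsOracleX val X Px)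
    (hPy : IsOracleY val y Py) (hX : ∀ k i, 0 ≤ X k i ∧ X k i ≤ 1)
    (hy : ∀ k, 0 ≤ y k ∧ y k ≤ 1) (i : Fin d) (o : Option (Fin d)) :
    star (loadOp Px Py o.isSome (permUnitary (storeValue i (o.getD i))) *ᵥ unloadedState i) ⬝ᵥ
      (valueReflection val : Matrix.unitaryGroup (Work d N m) ℂ).1 *ᵥ
        (loadOp Px Py o.isSome (permUnitary (storeValue i (o.getD i))) *ᵥ unloadedState i) =
      entry X y i o := by
  choose v hv hvq using fun k => hPx.2 i k
  choose w hw hwq using fun k => exists_secondOp_mulVec_single hPx hPy i o k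
  -- For an entry of z the default index is i, so the swap is trivial and the second query reads y.
  have hload : loadOp Px Py o.isSome (permUnitary (storeValue i (o.getD i))) *ᵥ unloadedState i =
      uniformState fun k : Fin N => ((o.getD i, k, w k), (v k, false)) := by
    refine mulVec_uniformState fun k => ?_
    rw [loadOp, ← Matrix.mulVec_mulVec, ← Matrix.mulVec_mulVec,
      kronecker_one_mulVec_single (hvq k), permUnitary_mulVec_single]
    simp only [storeValue, Equiv.coe_fn_mk, Equiv.swap_apply_left]
    exact kronecker_one_mulVec_single (hwq k) _
  rw [hload, valueReflection, star_uniformState_dotProduct_flipMatrix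
    (fun k l h => by simpa using congrArg (fun x => x.1.2.1) h)
    (fun k l h => by simpa [flipQubit] using congrArg (fun x => x.2.2) h), entry_eq_sum]
  congr 2
  refine Finset.sum_congr rfl fun k _ => ?_
  have hs : 0 ≤ secondValue X y k o ∧ secondValue X y k o ≤ 1 := by
    cases o with
    | some j => exact hX k j
    | none => exact hy k
  simp only [reflectionDiag, truncatedProduct, Bool.false_eq_true, if_false, hv, hw]
  have h0 := mul_nonneg (hX k i).1 hs.1
  have h1 := mul_le_one₀ (hX k i).2 hs.1 hs.2
  rw [min_eq_right h1, max_eq_right (by linarith)]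

/-- The algorithm with `4 q` steps of the walk in every run and with `n` runs for every entry,
given the preparation gates `P`, the reflections `F` at the unloaded states, the final gate `U`,
and the values `D` that are assigned to the measured clock values. -/
def leastSquaresAlgorithm (val : Bits m → ℝ) (q n : ℕ) (δ : ℝ)
    (s : Basis d N m ((Bits m × Bool) × Fin (4 * q + 1)))
    (P : Fin d → Matrix.unitaryGroup (Basis d N m ((Bits m × Bool) × Fin (4 * q + 1))) ℂ)
    (F : Fin d → Matrix.unitaryGroup (Work d N m) ℂ) (U : Matrix.unitaryGroup (Fin (4 * q + 1)) ℂ)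
    (D : Fin (4 * q + 1) → ℝ) : QueryAlgorithm d N m where
  ω := (Bits m × Bool) × Fin (4 * q + 1)
  ρ := (Fin d × Option (Fin d)) × Fin n
  init := s
  circuit r := estimationCircuit q r.1.2.isSome (P r.1.1)
    (permUnitary (storeValue r.1.1 (r.1.2.getD r.1.1))) (valueReflection val) (F r.1.1) U
  output o :=
    (Matrix.of fun i j => majority δ fun t => D (o ((i, some j), t)).2.2)⁻¹ *ᵥ
      fun i => majority δ fun t => D (o ((i, none), t)).2.2

section

variable (val : Bits m → ℝ) (q n : ℕ) (δ : ℝ)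
    (s : Basis d N m ((Bits m × Bool) × Fin (4 * q + 1)))
    (P : Fin d → Matrix.unitaryGroup (Basis d N m ((Bits m × Bool) × Fin (4 * q + 1))) ℂ)
    (F : Fin d → Matrix.unitaryGroup (Work d N m) ℂ) (U : Matrix.unitaryGroup (Fin (4 * q + 1)) ℂ)
    (D : Fin (4 * q + 1) → ℝ)

theorem usesX_leastSquaresAlgorithm_le :
    (leastSquaresAlgorithm val q n δ s P F U D).usesX ≤ d * (d + 1) * n * (16 * q + 2) := by
  refine (Finset.sum_le_sum fun r _ => sum_costX_estimationCircuit_le q _ _ _ _ _ _).trans ?_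
  rw [Finset.sum_const, smul_eq_mul]
  refine Nat.mul_le_mul_right _ (le_of_eq ?_)
  change Fintype.card ((Fin d × Option (Fin d)) × Fin n) = _
  simp

theorem usesY_leastSquaresAlgorithm_le :
    (leastSquaresAlgorithm val q n δ s P F U D).usesY ≤ d * n * (8 * q + 1) := by
  refine (Finset.sum_le_sum fun r _ => sum_costY_estimationCircuit_le q _ _ _ _ _ _).trans ?_
  change ∑ r : (Fin d × Option (Fin d)) × Fin n, (if r.1.2.isSome then 0 else 8 * q + 1) ≤ _
  simp [Fintype.sum_prod_type, Fintype.sum_option, mul_assoc]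

end

/-- The target set T separates the probabilistic part from the deterministic error analysis: it need
only contain the outputs computed from accurate estimates. -/
theorem exists_algorithm (hd : 0 < d) (hN : 0 < N) (val : Bits m → ℝ) {q : ℕ} (hq : 0 < q) (n : ℕ)
    {δ : ℝ} (hδ : 0 < δ) (hqδ : 3 / ((q : ℝ) ^ 2 * δ ^ 2) ≤ 1 / 64) :
    ∃ A : QueryAlgorithm d N m,
      A.usesX ≤ d * (d + 1) * n * (16 * q + 2) ∧ A.usesY ≤ d * n * (8 * q + 1) ∧
      ∀ (X : Matrix (Fin N) (Fin d) ℝ) (y : Fin N → ℝ), (∀ k i, 0 ≤ X k i ∧ X k i ≤ 1) →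
        (∀ k, 0 ≤ y k ∧ y k ≤ 1) →
        ∀ (Px : Matrix (Query d N m) (Query d N m) ℂ)
          (Py : Matrix (Fin N × Bits m) (Fin N × Bits m) ℂ),
          IsOracleX val X Px → IsOracleY val y Py →
          ∀ T : Set (Fin d → ℝ),
            (∀ (W : Matrix (Fin d) (Fin d) ℝ) (z : Fin d → ℝ),
              (∀ i j, |W i j - gram X i j| ≤ 2 * δ) → (∀ i, |z i - moment X y i| ≤ 2 * δ) →
              W⁻¹ *ᵥ z ∈ T) →
            1 - (d * (d + 1) : ℝ) * (1 / 4) ^ n ≤ A.prob Px Py T := by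
  classical
  obtain ⟨U, D, hU⟩ := exists_unitary_diagonalizing (isHermitian_pathMatrix (4 * q + 1))
  let s : Basis d N m ((Bits m × Bool) × Fin (4 * q + 1)) :=
    ((⟨0, hd⟩, ⟨0, hN⟩, zeroBits m), ((zeroBits m, false), 0))
  have hP : ∀ i : Fin d, ∃
      P : Matrix.unitaryGroup (Basis d N m ((Bits m × Bool) × Fin (4 * q + 1))) ℂ,
      P.1 *ᵥ ket s =
        join fun t : Fin (4 * q + 1) => (tentAmp q t : ℂ) • unloadedState i := by
    intro i
    refine exists_unitary_mulVec_single ?_ s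
    rw [← (Equiv.prodAssoc (Query d N m) (Bits m × Bool) (Fin (4 * q + 1))).sum_comp,
      Fintype.sum_prod_type, Finset.sum_comm]
    simp only [join, Equiv.prodAssoc_apply, Pi.smul_apply, smul_eq_mul, norm_mul, mul_pow,
      ← Finset.mul_sum, Complex.norm_real, Real.norm_eq_abs, sq_abs]
    simp only [Prod.mk.eta, sum_norm_sq_unloadedState hN, mul_one]
    exact sum_tentAmp_sq hq
  choose P hP using hP
  let F : Fin d → Matrix.unitaryGroup (Work d N m) ℂ := fun i =>
    ⟨reflectVec (unloadedState i), reflectVec_mem_unitaryGroup (sum_norm_sq_unloadedState hN i)⟩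
  refine ⟨leastSquaresAlgorithm val q n δ s P F U D, usesX_leastSquaresAlgorithm_le ..,
    usesY_leastSquaresAlgorithm_le .., ?_⟩
  intro X y hX hy Px Py hPx hPy T hT
  let p : (Fin d × Option (Fin d)) × Fin n → Basis d N m ((Bits m × Bool) × Fin (4 * q + 1)) → ℝ :=
    fun r b => ‖run Px Py (estimationCircuit q r.1.2.isSome (P r.1.1)
      (permUnitary (storeValue r.1.1 (r.1.2.getD r.1.1))) (valueReflection val) (F r.1.1) U)
        (ket s) b‖ ^ 2
  have hp : ∀ r b, 0 ≤ p r b := fun r b => sq_nonneg _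
  have hsum : ∀ r, ∑ b, p r b = 1 := fun r => by
    simp only [p]
    rw [sum_norm_sq_run hPx.1 hPy.1]
    simp [ket, Pi.single_apply, apply_ite]
  have hbad : ∀ r, ∑ b, p r b *
      (if ¬ |D b.2.2 - entry X y r.1.1 r.1.2| ≤ δ then 1 else 0) ≤ 1 / 64 := by
    intro r
    have h := sum_sq_mul_norm_sq_run_estimationCircuit_le hq hPx.1 hPy.1 r.1.2.isSome
      (sum_norm_sq_unloadedState hN r.1.1) (hP r.1.1) (F := F r.1.1) rfl
      (valueReflection_mul_self val)
      (star_loaded_dotProduct_valueReflection hPx hPy hX hy r.1.1 r.1.2) hU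
    refine le_trans ?_ hqδ
    -- Chebyshev's inequality for the measured eigenvalue.
    rw [← div_div, le_div_iff₀ (by positivity), Finset.sum_mul]
    refine le_trans (Finset.sum_le_sum fun b _ => ?_) h
    rw [mul_comm ((D b.2.2 - _) ^ 2), mul_assoc]
    refine mul_le_mul_of_nonneg_left ?_ (hp r b)
    split_ifs with hb
    · rw [zero_mul]; exact sq_nonneg _
    · rw [one_mul, ← sq_abs (D b.2.2 - _)]
      exact pow_le_pow_left₀ hδ.le (not_le.1 hb).le 2
  have hmain := one_sub_le_sum_indicator hp hsum hbad
    (S := {o | (leastSquaresAlgorithm val q n δ s P F U D).output o ∈ T}) (by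
      intro o ho
      refine hT _ _ (fun i j => ?_) fun i => ?_
      · exact abs_majority_sub_le (by simpa [entry] using ho (i, some j))
      · exact abs_majority_sub_le (by simpa [entry] using ho (i, none)))
  refine le_trans (le_of_eq ?_) hmain
  simp

end Algorithm

/-! ### Error analysis and choice of parameters -/

theorem abs_moment_le_one {d N : ℕ} (hN : 0 < N) {X : Matrix (Fin N) (Fin d) ℝ} {y : Fin N → ℝ}
    (hX : ∀ k i, 0 ≤ X k i ∧ X k i ≤ 1) (hy : ∀ k, 0 ≤ y k ∧ y k ≤ 1) (i : Fin d) :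
    |moment X y i| ≤ 1 := by
  have hN' : (0 : ℝ) < N := by exact_mod_cast hN
  have h : moment X y i = 1 / N * ∑ k, X k i * y k := by
    simp [moment, Matrix.mulVec, dotProduct]
  have h0 : 0 ≤ ∑ k, X k i * y k := Finset.sum_nonneg fun k _ => mul_nonneg (hX k i).1 (hy k).1
  have h1 : ∑ k, X k i * y k ≤ N := by
    refine (Finset.sum_le_card_nsmul _ _ 1 fun k _ =>
      mul_le_one₀ (hX k i).2 (hy k).1 (hy k).2).trans ?_
    simp
  rw [h, abs_of_nonneg (by positivity), one_div, inv_mul_le_iff₀ hN', mul_one]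
  exact h1

/-- Entrywise estimates of `W` and `z` with error `c / (2 Q)` give the coefficients up to a
constant times `ε`. -/
theorem norm_inv_mulVec_sub_coeffs_le {d N : ℕ} (hd : 0 < d) (hN : 0 < N)
    {X : Matrix (Fin N) (Fin d) ℝ} {y : Fin N → ℝ} {c κ ε Q : ℝ} (hc : 0 < c) (hκ : 1 ≤ κ)
    (hQ : d * κ ^ 2 ≤ Q) (hQε : (d : ℝ) * √d * κ ^ 4 ≤ Q * ε) (hrank : X.rank = d)
    (hcond : condNumber X ≤ κ) (hX : ∀ k i, 0 ≤ X k i ∧ X k i ≤ 1)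
    (hy : ∀ k, 0 ≤ y k ∧ y k ≤ 1) (hdiag : ∀ i, c < gram X i i)
    {W : Matrix (Fin d) (Fin d) ℝ} {z : Fin d → ℝ}
    (hW : ∀ i j, |W i j - gram X i j| ≤ c / (2 * Q))
    (hz : ∀ i, |z i - moment X y i| ≤ c / (2 * Q)) :
    ‖W⁻¹ *ᵥ z - coeffs X y‖ ≤ (1 + 1 / c) * ε := by
  have hd' : (1 : ℝ) ≤ d := by exact_mod_cast hd
  have hκ0 : 0 < κ := by linarith
  have hQ0 : 0 < Q := lt_of_lt_of_le (by positivity) hQ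
  refine (norm_inv_mulVec_sub_le (l := c / κ ^ 2) (by positivity) (by positivity)
    (le_dotProduct_gram_mulVec hd hN hκ hrank hcond hdiag) (abs_moment_le_one hN hX hy)
    hW hz ?_).trans ?_
  -- The smallness condition dδ ≤ l/2 is exactly Q ≥ dκ².
  · rw [div_div, mul_div_assoc', div_le_div_iff₀ (by positivity) (by positivity)]
    nlinarith [mul_le_mul_of_nonneg_left hQ hc.le]
  · have h1 : 2 / (c / κ ^ 2) * (√d * (c / (2 * Q)) + d * √d * (c / (2 * Q)) / (c / κ ^ 2)) =
        (√d * κ ^ 2 + d * √d * κ ^ 4 / c) / Q := by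
      field_simp
    have h2 : √d * κ ^ 2 ≤ d * √d * κ ^ 4 := by
      have : κ ^ 2 ≤ κ ^ 4 := pow_le_pow_right₀ hκ (by norm_num)
      calc √d * κ ^ 2 = 1 * √d * κ ^ 2 := by ring
        _ ≤ _ := by gcongr
    rw [h1, div_le_iff₀ hQ0]
    calc _ ≤ d * √d * κ ^ 4 + d * √d * κ ^ 4 / c := by gcongr
      _ = (1 + 1 / c) * (d * √d * κ ^ 4) := by ring
      _ ≤ (1 + 1 / c) * (Q * ε) := by gcongr
      _ = _ := by ring

/-- A positive lower bound valid even for d = 1 lets the rounding of the number of runs be absorbed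
into the constant. -/
theorem half_le_log_add_one {d : ℕ} (hd : 0 < d) : 1 / 2 ≤ Real.log ((d : ℝ) + 1) := by
  have hd' : (1 : ℝ) ≤ d := by exact_mod_cast hd
  have h := Real.log_le_log (by norm_num : (0 : ℝ) < 2) (by linarith : (2 : ℝ) ≤ d + 1)
  have := Real.log_two_gt_d9
  linarith

/-- Logarithmically many repetitions suffice for all entries. -/
theorem failure_bound {d n : ℕ} (hd : 0 < d) (hn : 10 * Real.log ((d : ℝ) + 1) ≤ n) :
    (d * (d + 1) : ℝ) * (1 / 4) ^ n < 1 / 100 := by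
  have hd' : (1 : ℝ) ≤ d := by exact_mod_cast hd
  have h1 : (1 / 4 : ℝ) ≤ Real.exp (-1) := by
    rw [Real.exp_neg, one_div]
    exact inv_anti₀ (Real.exp_pos 1) (by have := Real.exp_one_lt_d9; linarith)
  have h2 : (1 / 4 : ℝ) ^ n ≤ (((d : ℝ) + 1) ^ 10)⁻¹ := by
    calc (1 / 4 : ℝ) ^ n ≤ Real.exp (-1) ^ n := by gcongr
      _ = Real.exp (-n) := by rw [← Real.exp_nat_mul]; ring_nf
      _ ≤ Real.exp (-(10 * Real.log ((d : ℝ) + 1))) := by gcongr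
      _ = _ := by
        rw [Real.exp_neg, ← Real.log_rpow (by positivity), Real.exp_log (by positivity)]
        norm_cast
  -- The worst case is d = 1, where 2⁸ > 100.
  have h3 : (256 : ℝ) ≤ ((d : ℝ) + 1) ^ 8 := by
    calc (256 : ℝ) = (1 + 1) ^ 8 := by norm_num
      _ ≤ _ := by gcongr
  calc (d * (d + 1) : ℝ) * (1 / 4) ^ n ≤ ((d + 1) * (d + 1)) * (((d : ℝ) + 1) ^ 10)⁻¹ := by
        gcongr; linarith
    _ = (((d : ℝ) + 1) ^ 8)⁻¹ := by field_simp
    _ ≤ 256⁻¹ := by gcongr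
    _ < _ := by norm_num

end QLinReg
end

theorem theorem1 (c : ℝ) (hc : 0 < c) :
    ∃ C : ℝ, 0 < C ∧
      ∀ (d N m : ℕ) (val : QLinReg.Bits m → ℝ) (κ ε : ℝ),
        0 < d → 0 < N → 1 ≤ κ → 0 < ε →
        ∃ A : QLinReg.QueryAlgorithm d N m,
          (A.usesX : ℝ) ≤
            C * (max ((d : ℝ) ^ (3 / 2 : ℝ) * κ ^ 4 / ε) ((d : ℝ) * κ ^ 2)
              * ((d : ℝ) ^ 2 * Real.log ((d : ℝ) + 1))) ∧
          (A.usesY : ℝ) ≤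
            C * (max ((d : ℝ) ^ (3 / 2 : ℝ) * κ ^ 4 / ε) ((d : ℝ) * κ ^ 2)
              * ((d : ℝ) * Real.log ((d : ℝ) + 1))) ∧
          ∀ (X : Matrix (Fin N) (Fin d) ℝ) (y : Fin N → ℝ),
            X.rank = d →
            QLinReg.condNumber X ≤ κ →
            (∀ k i, 0 ≤ X k i ∧ X k i ≤ 1) →
            (∀ k, 0 ≤ y k ∧ y k ≤ 1) →
            (∀ i, c < QLinReg.gram X i i) →
            ∀ (Px : Matrix (Fin d × Fin N × QLinReg.Bits m) (Fin d × Fin N × QLinReg.Bits m) ℂ)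
              (Py : Matrix (Fin N × QLinReg.Bits m) (Fin N × QLinReg.Bits m) ℂ),
              QLinReg.IsOracleX val X Px →
              QLinReg.IsOracleY val y Py →
              99 / 100 < A.prob Px Py {a | ‖a - QLinReg.coeffs X y‖ ≤ C * ε} := by
  -- The first summand serves the query counts, with 432 = 36 · 12 from d(d+1)(16q+2) ≤ 36d²q and n
  -- ≤ 12ℓ; the second serves the accuracy.
  refine ⟨432 * (56 / c + 1) + (1 + 1 / c), by positivity, ?_⟩
  intro d N m val κ ε hd hN hκ hε
  have hd' : (1 : ℝ) ≤ d := by exact_mod_cast hd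
  set Q : ℝ := max ((d : ℝ) ^ (3 / 2 : ℝ) * κ ^ 4 / ε) ((d : ℝ) * κ ^ 2) with hQdef
  set ℓ : ℝ := Real.log ((d : ℝ) + 1) with hℓdef
  have hQ : d * κ ^ 2 ≤ Q := le_max_right _ _
  have hQ1 : 1 ≤ Q := (one_le_mul_of_one_le_of_one_le hd' (one_le_pow₀ hκ)).trans hQ
  have hQε : (d : ℝ) * √d * κ ^ 4 ≤ Q * ε := by
    have h : (d : ℝ) ^ (3 / 2 : ℝ) = d * √d := by
      rw [show (3 / 2 : ℝ) = 1 + 1 / 2 by norm_num, Real.rpow_add (by linarith), Real.rpow_one,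
        Real.sqrt_eq_rpow]
    rw [← h, ← div_le_iff₀ hε]
    exact le_max_left _ _
  have hℓ : 1 / 2 ≤ ℓ := QLinReg.half_le_log_add_one hd
  obtain ⟨n, hn⟩ : ∃ n, n = ⌈10 * ℓ⌉₊ := ⟨_, rfl⟩
  obtain ⟨q, hqdef⟩ : ∃ q, q = ⌈56 / c * Q⌉₊ := ⟨_, rfl⟩
  have hn1 : 10 * ℓ ≤ n := hn ▸ Nat.le_ceil _
  have hn2 : (n : ℝ) ≤ 12 * ℓ := by
    have := Nat.ceil_lt_add_one (a := 10 * ℓ) (by linarith)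
    rw [← hn] at this; linarith
  have hKQ : 0 < 56 / c * Q := by positivity
  have hq : 0 < q := hqdef ▸ Nat.ceil_pos.2 hKQ
  have hq0 : (1 : ℝ) ≤ q := by exact_mod_cast hq
  have hq1 : 56 / c * Q ≤ q := hqdef ▸ Nat.le_ceil _
  have hq2 : (q : ℝ) ≤ (56 / c + 1) * Q := by
    have := Nat.ceil_lt_add_one hKQ.le
    rw [← hqdef] at this; linarith
  have hδ0 : 0 < c / (4 * Q) := by positivity
  obtain ⟨A, hAX, hAY, hA⟩ := QLinReg.exists_algorithm hd hN val hq n hδ0 (by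
      -- The constant 56 = 4 · 14 is chosen so that 14² = 196 exceeds 3 · 64 = 192.
      have h : 14 ≤ q * (c / (4 * Q)) := by
        calc (14 : ℝ) = 56 / c * Q * (c / (4 * Q)) := by field_simp; norm_num
          _ ≤ _ := by gcongr
      rw [← mul_pow, div_le_div_iff₀ (by positivity) (by norm_num)]
      nlinarith)
  have hnq : (n : ℝ) * q ≤ 12 * (56 / c + 1) * (Q * ℓ) := by
    calc (n : ℝ) * q ≤ (12 * ℓ) * ((56 / c + 1) * Q) := by gcongr
      _ = _ := by ring
  refine ⟨A, ?_, ?_, ?_⟩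
  · calc (A.usesX : ℝ) ≤ ((d * (d + 1) * n * (16 * q + 2) : ℕ) : ℝ) := by exact_mod_cast hAX
      _ = d * (d + 1) * n * (16 * q + 2) := by push_cast; ring
      _ ≤ d * (d + d) * n * (18 * q) := by gcongr; linarith
      _ = 36 * d ^ 2 * (n * q) := by ring
      _ ≤ 36 * d ^ 2 * (12 * (56 / c + 1) * (Q * ℓ)) := by gcongr
      _ = 432 * (56 / c + 1) * (Q * (d ^ 2 * ℓ)) := by ring
      _ ≤ _ := by
        gcongr
        exact le_add_of_nonneg_right (by positivity)
  · calc (A.usesY : ℝ) ≤ ((d * n * (8 * q + 1) : ℕ) : ℝ) := by exact_mod_cast hAY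
      _ = d * n * (8 * q + 1) := by push_cast; ring
      _ ≤ d * n * (36 * q) := by gcongr; linarith
      _ = 36 * d * (n * q) := by ring
      _ ≤ 36 * d * (12 * (56 / c + 1) * (Q * ℓ)) := by gcongr
      _ = 432 * (56 / c + 1) * (Q * (d * ℓ)) := by ring
      _ ≤ _ := by
        gcongr
        exact le_add_of_nonneg_right (by positivity)
  · intro X y hrank hcond hX hy hdiag Px Py hPx hPy
    have hfail := QLinReg.failure_bound hd hn1
    refine lt_of_lt_of_le (by linarith) (hA X y hX hy Px Py hPx hPy _ fun W z hW hz => ?_)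
    -- The majority vote doubles the error of a single run.
    have hδ : 2 * (c / (4 * Q)) = c / (2 * Q) := by field_simp; norm_num
    rw [hδ] at hW hz
    refine (QLinReg.norm_inv_mulVec_sub_coeffs_le hd hN hc hκ hQ hQε hrank hcond hX hy hdiag
      hW hz).trans ?_
    exact mul_le_mul_of_nonneg_right (le_add_of_nonneg_left (by positivity)) hε.le
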